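/- Let $K$ be an algebraically closed field and let $k\ge 3$; if $k=4$, assume that the characteristic of $K$ is not $3$. Let $\nu:(\mathbb{P}^1)^k\to\mathbb{P}^{2^k-1}$ be the Segre embedding over $K$, let $X$ be its image, and let $\pi_i:(\mathbb{P}^1)^k\to\mathbb{P}^1$ be the projection onto the $i$-th factor. For a closed subscheme $Z\subset(\mathbb{P}^1)^k$ let $\langle\nu(Z)\rangle$ be the smallest linear subspace of $\mathbb{P}^{2^k-1}$ that contains the scheme $\nu(Z)$. For $p\in\mathbb{P}^{2^k-1}$ let the $X$-rank $r_X(p)$ be the least number of points of $X$ whose linear span contains $p$. A zero-dimensional scheme is called curvilinear if its Zariski tangent space at each of its points has dimension at most $1$. Let $\Gamma\subset(\mathbb{P}^1)^k$ be a connected curvilinear zero-dimensional closed subscheme of degree $3$ such that the scheme-theoretic image $\pi_i(\Gamma)$ has degree $3$ for every $i=1,\dots,k$. Then $\Gamma$ has exactly one subscheme $\beta$ of degree $2$, and the following hold. (a) If $k=3$, then $2\le r_X(p)\le 3$ for every $p\in\langle\nu(\Gamma)\rangle\setminus\langle\nu(\beta)\rangle$, and there is a nonempty Zariski open subset $U$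 of $\langle\nu(\Gamma)\rangle$ such that $r_X(p)=2$ for every $p\in U$. (b) If $k\ge 4$, then $r_X(p)=k-1$ for every $p\in\langle\nu(\Gamma)\rangle\setminus\langle\nu(\beta)\rangle$. -/

import Mathlib

open scoped LinearAlgebra.Projectivization

/-! ## Projective geometry: linear spans, `X`-rank, general points -/

/-- The `X`-rank of a point `p` of the projective space `ℙ K V`: the least number of points of `X`
whose linear span contains `p`. (By convention it is `0` if `p` is not in the span of `X`.) -/
noncomputable def projRank {K V : Type*} [Field K] [AddCommGroup V] [Module K V]
    (X : Set (ℙ K V)) (p : ℙ K V) : ℕ :=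
  sInf {s | ∃ A : Finset (ℙ K V), (A : Set (ℙ K V)) ⊆ X ∧ A.card = s ∧
    p.submodule ≤ ⨆ x ∈ A, x.submodule}

/-- A property `P` holds for a general point of the linear subspace `ℙ(L)` of a projective space
with homogeneous coordinates indexed by `σ`: it holds at all points of some nonempty Zariski open
subset of `ℙ(L)`, here a basic one, the locus in `ℙ(L)` where a form `F` does not vanish. -/
def HoldsGenerally {K σ : Type*} [Field K] (L : Submodule K (σ → K)) (P : ℙ K (σ → K) → Prop) :
    Prop :=
  ∃ (n : ℕ) (F : MvPolynomial σ K), F.IsHomogeneous n ∧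
    (∃ p : ℙ K (σ → K), p.submodule ≤ L ∧ MvPolynomial.eval p.rep F ≠ 0) ∧
    ∀ p : ℙ K (σ → K), p.submodule ≤ L → MvPolynomial.eval p.rep F ≠ 0 → P p

/-! ## The variety `(ℙ¹)^ι` and its closed subschemes -/

namespace MultiP1

/-- The multidegree of the coordinate `x_{i,j}` (`j = 0, 1`) of the `i`-th factor of `(ℙ¹)^ι` is
the `i`-th basis vector `ε_i`. -/
def mdeg (ι : Type*) [DecidableEq ι] : ι × Fin 2 → (ι → ℕ) :=
  fun v => Pi.single v.1 1

/-- Multihomogeneous forms of multidegree `d` in the coordinates of `(ℙ¹)^ι`, i.e. the space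
`H⁰(𝒪(d))`. -/
noncomputable def forms (ι : Type*) (K : Type*) [DecidableEq ι] [Field K] (d : ι → ℕ) :
    Submodule K (MvPolynomial (ι × Fin 2) K) :=
  MvPolynomial.weightedHomogeneousSubmodule K (mdeg ι) d

/-- The (closed) points of `(ℙ¹)^ι`. -/
def Point (ι : Type*) (K : Type*) [Field K] : Type _ := ι → ℙ K (Fin 2 → K)

/-- A choice of multihomogeneous coordinates of a point of `(ℙ¹)^ι`. -/
noncomputable def Point.coords {ι K : Type*} [Field K] (q : Point ι K) : ι × Fin 2 → K :=
  fun v => (q v.1).rep v.2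

/-- The Zariski topology on the points of `(ℙ¹)^ι`: the loci where a multihomogeneous form does
not vanish form a basis of open sets. -/
instance zariski (ι : Type*) (K : Type*) [DecidableEq ι] [Field K] :
    TopologicalSpace (Point ι K) :=
  TopologicalSpace.generateFrom
    {U | ∃ (d : ι → ℕ), ∃ f ∈ forms ι K d, U = {q | MvPolynomial.eval q.coords f ≠ 0}}

/-- A closed subscheme of `(ℙ¹)^ι`, given by its multihomogeneous ideal, which is saturated with
respect to the irrelevant ideal `∏ᵢ (x_{i,0}, x_{i,1})`; this ideal is generated by the monomials
`∏ᵢ x_{i,c(i)}`. Closed subschemes correspond bijectively to such ideals. -/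
@[ext]
structure ClosedSubscheme (ι : Type*) (K : Type*) [Fintype ι] [DecidableEq ι] [Field K] where
  ideal : Ideal (MvPolynomial (ι × Fin 2) K)
  multihomogeneous : ∀ f ∈ ideal, ∀ d : ι → ℕ,
    MvPolynomial.weightedHomogeneousComponent (mdeg ι) d f ∈ ideal
  saturated : ∀ f : MvPolynomial (ι × Fin 2) K,
    (∀ c : ι → Fin 2, (∏ i, MvPolynomial.X (i, c i)) * f ∈ ideal) → f ∈ ideal

/-- Pulling back forms from the `i`-th factor is compatible with taking components. -/
theorem rename_component {ι K : Type*} [DecidableEq ι] [Field K] (i : ι) (n : Unit → ℕ)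
    (f : MvPolynomial (Unit × Fin 2) K) :
    MvPolynomial.rename (fun v : Unit × Fin 2 => (i, v.2))
        (MvPolynomial.weightedHomogeneousComponent (mdeg Unit) n f) =
      MvPolynomial.weightedHomogeneousComponent (mdeg ι) (Pi.single i (n ()))
        (MvPolynomial.rename (fun v : Unit × Fin 2 => (i, v.2)) f) := by
  induction f using MvPolynomial.induction_on' with
  | add p q hp hq => simp only [map_add, hp, hq]
  | monomial u a =>
    have key : Finsupp.weight (mdeg ι) (u.mapDomain fun v : Unit × Fin 2 => (i, v.2)) =
        Pi.single i (Finsupp.weight (mdeg Unit) u ()) := by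
      ext j
      rw [Finsupp.weight_apply, Finsupp.weight_apply, Finsupp.sum_mapDomain_index
        (h := fun v c => c • mdeg ι v) (fun _ => zero_smul _ _) (fun _ _ _ => add_smul _ _ _)]
      by_cases hj : j = i
      · subst hj
        simp [Finsupp.sum, mdeg]
      · simp [Finsupp.sum, mdeg, hj]
    have h1 := MvPolynomial.isWeightedHomogeneous_monomial (R := K) (mdeg Unit) u a rfl
    have h2 := MvPolynomial.isWeightedHomogeneous_monomial (R := K) (mdeg ι) _ a key
    rw [MvPolynomial.rename_monomial]
    by_cases hn : Finsupp.weight (mdeg Unit) u = n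
    · subst hn
      rw [h1.weightedHomogeneousComponent_same, h2.weightedHomogeneousComponent_same,
        MvPolynomial.rename_monomial]
    · rw [h1.weightedHomogeneousComponent_ne _ (Ne.symm hn),
        h2.weightedHomogeneousComponent_ne _ (fun h => hn ?_), map_zero]
      funext x
      simpa using (congrFun h i).symm

namespace ClosedSubscheme

variable {ι K : Type*} [Fintype ι] [DecidableEq ι] [Field K]

/-- `A ≤ B` means that `A` is a closed subscheme of `B`. -/
instance : LE (ClosedSubscheme ι K) := ⟨fun A B => B.ideal ≤ A.ideal⟩

/-- The Hilbert function: `d ↦ dim H⁰(𝒪(d)) / H⁰(𝓘_Γ(d))`. -/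
noncomputable def hilbertFunction (Γ : ClosedSubscheme ι K) (d : ι → ℕ) : ℕ :=
  Module.finrank K
    (forms ι K d ⧸ (Γ.ideal.restrictScalars K).comap (forms ι K d).subtype)

/-- `Γ` is zero-dimensional (or empty) of degree `n`: its Hilbert function is equal to `n` in all
large multidegrees, i.e. its Hilbert polynomial is the constant `n`. -/
def HasDegree (Γ : ClosedSubscheme ι K) (n : ℕ) : Prop :=
  ∀ᶠ d : ι → ℕ in Filter.atTop, Γ.hilbertFunction d = n

/-- The set of (closed) points of `Γ`. -/
def support (Γ : ClosedSubscheme ι K) : Set (Point ι K) :=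
  {q | ∀ f ∈ Γ.ideal, MvPolynomial.eval q.coords f = 0}

/-- `Γ` is connected. -/
def Connected (Γ : ClosedSubscheme ι K) : Prop := IsConnected Γ.support

/-- The linear form `w ↦ ∑ᵥ (∂f/∂xᵥ)(q) wᵥ`. -/
noncomputable def differential (f : MvPolynomial (ι × Fin 2) K) (q : Point ι K) :
    Module.Dual K (ι × Fin 2 → K) :=
  ∑ v, MvPolynomial.eval q.coords (MvPolynomial.pderiv v f) • LinearMap.proj v

/-- The linear map `a ↦ (a_i q_i)_i`. Its range is the space of the directions along which the
point `q` of `(ℙ¹)^ι` does not move, so that the tangent space of `(ℙ¹)^ι` at `q` is the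
quotient of `∏ᵢ K²` by this range. -/
noncomputable def radial (q : Point ι K) : (ι → K) →ₗ[K] (ι × Fin 2 → K) :=
  LinearMap.pi fun v => q.coords v • LinearMap.proj v.1

/-- The Zariski tangent space of `Γ` at a point `q` of `Γ`, as a subspace of the tangent space of
`(ℙ¹)^ι` at `q`: the common kernel of the differentials of the equations of `Γ`. -/
noncomputable def tangentSpace (Γ : ClosedSubscheme ι K) (q : Point ι K) :
    Submodule K ((ι × Fin 2 → K) ⧸ LinearMap.range (radial q)) :=
  (⨅ f ∈ Γ.ideal, LinearMap.ker (differential f q)).map (LinearMap.range (radial q)).mkQ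

/-- `Γ` is curvilinear: it is zero-dimensional, and its Zariski tangent spaces have dimension at
most one. -/
def Curvilinear (Γ : ClosedSubscheme ι K) : Prop :=
  (∃ n, Γ.HasDegree n) ∧ ∀ q ∈ Γ.support, Module.finrank K (Γ.tangentSpace q) ≤ 1

/-- The scheme-theoretic image `π_i(Γ)` of `Γ` in the `i`-th factor `ℙ¹`: its equations are the
forms on `ℙ¹` whose pullback to `(ℙ¹)^ι` vanishes on `Γ`. -/
noncomputable def image (Γ : ClosedSubscheme ι K) (i : ι) : ClosedSubscheme Unit K where
  ideal := Γ.ideal.comap (MvPolynomial.rename fun v : Unit × Fin 2 => (i, v.2))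
  multihomogeneous f hf n := by
    rw [Ideal.mem_comap] at hf ⊢
    rw [rename_component]
    exact Γ.multihomogeneous _ hf _
  saturated f hf := by
    rw [Ideal.mem_comap]
    refine Γ.saturated _ fun c => ?_
    have h := hf fun _ => c i
    simp only [Ideal.mem_comap, map_mul, MvPolynomial.rename_X,
      Finset.univ_unique, Finset.prod_singleton] at h
    rw [← Finset.mul_prod_erase Finset.univ _ (Finset.mem_univ i), mul_comm (MvPolynomial.X _),
      mul_assoc]
    exact Ideal.mul_mem_left _ _ h

end ClosedSubscheme

/-! ## The Segre embedding -/

/-- The homogeneous coordinates of the target `ℙ^{2^k-1}` of the Segre embedding of `(ℙ¹)^ι`,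
`k = #ι`, are indexed by the functions `c : ι → Fin 2`. -/
abbrev SegreCoords (ι : Type*) (K : Type*) : Type _ := (ι → Fin 2) → K

/-- The Segre embedding `ν`: its coordinates are the monomials `∏ᵢ x_{i,c(i)}`. -/
noncomputable def segre {ι K : Type*} [Fintype ι] [DecidableEq ι] [Field K] (q : Point ι K) :
    ℙ K (SegreCoords ι K) :=
  Projectivization.mk K (fun c : ι → Fin 2 => ∏ i, (q i).rep (c i)) (by
    have h : ∀ i, ∃ j, (q i).rep j ≠ 0 := fun i => Function.ne_iff.mp (q i).rep_nonzero
    choose c hc using h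
    exact Function.ne_iff.mpr ⟨c, Finset.prod_ne_zero_iff.mpr fun i _ => hc i⟩)

/-- The pullback under the Segre embedding of a linear form on the target: a form of multidegree
`(1, …, 1)`. -/
noncomputable def pullback {ι K : Type*} [Fintype ι] [DecidableEq ι] [Field K]
    (φ : Module.Dual K (SegreCoords ι K)) : MvPolynomial (ι × Fin 2) K :=
  ∑ c : ι → Fin 2, MvPolynomial.C (φ (Pi.single c 1)) * ∏ i, MvPolynomial.X (i, c i)

/-- The linear span `⟨ν(Γ)⟩` (as a vector subspace): the intersection of all the hyperplanes
that contain the scheme `ν(Γ)`. -/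
noncomputable def segreSpan {ι K : Type*} [Fintype ι] [DecidableEq ι] [Field K]
    (Γ : ClosedSubscheme ι K) : Submodule K (SegreCoords ι K) :=
  ⨅ φ ∈ {φ : Module.Dual K (SegreCoords ι K) | pullback φ ∈ Γ.ideal}, LinearMap.ker φ

/-- The rank of a point with respect to the Segre variety `X = ν((ℙ¹)^ι)`. -/
noncomputable def segreRank {ι K : Type*} [Fintype ι] [DecidableEq ι] [Field K]
    (p : ℙ K (SegreCoords ι K)) : ℕ :=
  projRank (Set.range (segre : Point ι K → ℙ K (SegreCoords ι K))) p

end MultiP1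

/-! The scheme Γ turns out to be the second-order jet at `t = 0` of a curve `t ↦ (vᵢ + t wᵢ)ᵢ` that
is linear in every factor, with `vᵢ, wᵢ` a basis of `K²` (`exists_eq_jetScheme`). Its coordinate
algebra has dimension 3. It is generated by the local coordinate of any one factor because each
projection has degree 3, and that coordinate is nilpotent because Γ is connected. So the algebra is
`K[s]/s³`, the `i`-th coordinate is `αᵢ s + βᵢ s²` with `αᵢ ≠ 0`, and multiplying the homogeneous
coordinates by the unit `1 - (βᵢ/αᵢ) s` removes the quadratic term.

Let `Tₙ` be the coefficient of `tⁿ` in `⊗ᵢ (vᵢ + t wᵢ)`. Then `⟨ν(Γ)⟩` is spanned by `T₀, T₁, T₂`.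
The only subscheme of degree 2 is `t² = 0`, whose span is that of `T₀, T₁` (`eq_jetScheme_two`,
`segreSpan_jetScheme`). The points to study are therefore `a T₀ + b T₁ + c T₂` with `c ≠ 0`.

Lower bound `k - 1` (`le_card_add_one_of_jetTensor_eq_sum`): contract the first factor with a linear
form that kills one summand but not `v₀`. The shape of the tensor persists, and one factor and one
summand disappear; then induct.

Upper bound (`jetTensor_eq_sum_of_apolar`): this is Sylvester's apolarity on the rational normal
curve `x ↦ ⊗ᵢ (wᵢ + x vᵢ)`. With `c = 1`, the point gives the functional `ℓ = a W_k + b W_{k-1} +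
W_{k-2}` on polynomials of degree at most `k`. If `ℓ` kills the multiples of a separable `h`, the
point is a combination of the points of the curve at the roots of `h`. In degree `k - 1` this
prescribes only the two coefficients of `h` below the leading one. For `k ≥ 4` the constant term
remains free, and varying it makes `h` separable unless its derivative vanishes identically, the
danger being `k = 4` in characteristic 3. For `k = 3` the quadric `h` is determined, its
discriminant cuts out the exceptional points, and a cubic `h` handles these. -/

namespace MultiP1

/-! ## Jets of lines and the tensors they span -/

section Tensors

open Polynomial

variable {ι K : Type*} [Fintype ι] [Field K]

/-- The decomposable tensor `⊗ᵢ uᵢ`. -/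
def segreVec {A : Type*} [CommSemiring A] (u : ι → Fin 2 → A) : (ι → Fin 2) → A :=
  fun c => ∏ i, u i (c i)

/-- The line `t ↦ (vᵢ + t wᵢ)ᵢ`. -/
noncomputable def line {ι : Type*} (v w : ι → Fin 2 → K) : ι → Fin 2 → K[X] :=
  fun i j => C (v i j) + X * C (w i j)

/-- The coefficient of `tⁿ` in `⊗ᵢ (vᵢ + t wᵢ)`. -/
noncomputable def jetTensor (v w : ι → Fin 2 → K) (n : ℕ) : SegreCoords ι K :=
  fun c => (segreVec (line v w) c).coeff n

/-- `vᵢ, wᵢ` is a basis of `K²` for every `i`. -/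
def IsFrame {ι : Type*} (v w : ι → Fin 2 → K) : Prop := ∀ i, v i 0 * w i 1 - v i 1 * w i 0 ≠ 0

/-- The first vector of the basis dual to `vᵢ, wᵢ`. -/
noncomputable def dualFst {ι : Type*} (v w : ι → Fin 2 → K) (i : ι) : Fin 2 → K :=
  (v i 0 * w i 1 - v i 1 * w i 0)⁻¹ • ![w i 1, -w i 0]

/-- The second vector of the basis dual to `vᵢ, wᵢ`. -/
noncomputable def dualSnd {ι : Type*} (v w : ι → Fin 2 → K) (i : ι) : Fin 2 → K :=
  (v i 0 * w i 1 - v i 1 * w i 0)⁻¹ • ![-v i 1, v i 0]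

theorem IsFrame.dualFst_fst {ι : Type*} {v w : ι → Fin 2 → K}
    (h : IsFrame v w) (i : ι) : ∑ j, dualFst v w i j * v i j = 1 := by
  have := h i
  simp only [dualFst, Fin.sum_univ_two, Pi.smul_apply, Matrix.cons_val_zero, Matrix.cons_val_one,
    smul_eq_mul]
  field_simp
  ring

theorem dualFst_snd {ι : Type*} (v w : ι → Fin 2 → K) (i : ι) : ∑ j, dualFst v w i j * w i j = 0 := by
  simp only [dualFst, Fin.sum_univ_two, Pi.smul_apply, Matrix.cons_val_zero, Matrix.cons_val_one,
    smul_eq_mul]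
  ring

theorem dualSnd_fst {ι : Type*} (v w : ι → Fin 2 → K) (i : ι) : ∑ j, dualSnd v w i j * v i j = 0 := by
  simp only [dualSnd, Fin.sum_univ_two, Pi.smul_apply, Matrix.cons_val_zero, Matrix.cons_val_one,
    smul_eq_mul]
  ring

theorem IsFrame.dualSnd_snd {ι : Type*} {v w : ι → Fin 2 → K}
    (h : IsFrame v w) (i : ι) : ∑ j, dualSnd v w i j * w i j = 1 := by
  have := h i
  simp only [dualSnd, Fin.sum_univ_two, Pi.smul_apply, Matrix.cons_val_zero, Matrix.cons_val_one,
    smul_eq_mul]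
  field_simp
  ring

/-- The linear form on tensors given by the decomposable tensor `⊗ᵢ ηᵢ` of linear forms. -/
def pairing [DecidableEq ι] (η : ι → Fin 2 → K) : SegreCoords ι K →ₗ[K] K :=
  ∑ c : ι → Fin 2, (∏ i, η i (c i)) • LinearMap.proj c

theorem pairing_jetTensor [DecidableEq ι] (η v w : ι → Fin 2 → K) (n : ℕ) :
    pairing η (jetTensor v w n) =
      (∏ i, (C (∑ j, η i j * v i j) + X * C (∑ j, η i j * w i j))).coeff n := by
  have h : ∀ i, C (∑ j, η i j * v i j) + X * C (∑ j, η i j * w i j) =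
      ∑ j, C (η i j) * line v w i j := by
    intro i
    simp only [line, map_sum, map_mul, Finset.mul_sum, ← Finset.sum_add_distrib]
    exact Finset.sum_congr rfl fun j _ => by ring
  simp only [h, Finset.prod_univ_sum, Finset.prod_mul_distrib, Fintype.piFinset_univ,
    Polynomial.finsetSum_coeff, ← map_prod, coeff_C_mul]
  simp [pairing, jetTensor, segreVec]

/-- On the curve each factor contributes `X` for `i ∈ s` and `1` otherwise, so the product is `X ^
s.card`. Hence the tensors `Tₙ` with `n ≤ k` are linearly independent. -/
theorem IsFrame.pairing_jetTensor [DecidableEq ι] {v w : ι → Fin 2 → K} (h : IsFrame v w)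
    (s : Finset ι) (n : ℕ) :
    pairing (fun i => if i ∈ s then dualSnd v w i else dualFst v w i) (jetTensor v w n) =
      if n = s.card then 1 else 0 := by
  rw [MultiP1.pairing_jetTensor]
  have : ∀ i, C (∑ j, (if i ∈ s then dualSnd v w i else dualFst v w i) j * v i j) +
      X * C (∑ j, (if i ∈ s then dualSnd v w i else dualFst v w i) j * w i j) =
      if i ∈ s then (X : K[X]) else 1 := by
    intro i
    split_ifs
    · rw [dualSnd_fst, h.dualSnd_snd]; simp
    · rw [h.dualFst_fst, dualFst_snd]; simp
  simp only [this, Finset.prod_ite_mem, Finset.univ_inter, Finset.prod_const, coeff_X_pow]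

end Tensors

/-! ## The lower bound for the rank -/

section LowerBound

open Polynomial

variable {K : Type*} [Field K] {k : ℕ}

/-- Contraction of a tensor with a linear form on the first factor. -/
def contractFirst (φ : Fin 2 → K) :
    SegreCoords (Fin (k + 1)) K →ₗ[K] SegreCoords (Fin k) K :=
  LinearMap.pi fun c => ∑ j, φ j • LinearMap.proj (Fin.cons j c : Fin (k + 1) → Fin 2)

theorem contractFirst_apply (φ : Fin 2 → K) (T : SegreCoords (Fin (k + 1)) K) (c : Fin k → Fin 2) :
    contractFirst φ T c = ∑ j, φ j * T (Fin.cons j c : Fin (k + 1) → Fin 2) := by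
  simp [contractFirst]

theorem contractFirst_segreVec (φ : Fin 2 → K) (u : Fin (k + 1) → Fin 2 → K) :
    contractFirst φ (segreVec u) = (∑ j, φ j * u 0 j) • segreVec (fun i => u i.succ) := by
  ext c
  simp [contractFirst_apply, segreVec, Fin.prod_univ_succ]
  ring

theorem contractFirst_jetTensor_zero (φ : Fin 2 → K) (v w : Fin (k + 1) → Fin 2 → K) :
    contractFirst φ (jetTensor v w 0) =
      (∑ j, φ j * v 0 j) • jetTensor (fun i => v i.succ) (fun i => w i.succ) 0 := by
  ext c
  simp [contractFirst_apply, jetTensor, segreVec, line, Fin.prod_univ_succ]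
  ring

theorem contractFirst_jetTensor_succ (φ : Fin 2 → K) (v w : Fin (k + 1) → Fin 2 → K) (n : ℕ) :
    contractFirst φ (jetTensor v w (n + 1)) =
      (∑ j, φ j * v 0 j) • jetTensor (fun i => v i.succ) (fun i => w i.succ) (n + 1) +
      (∑ j, φ j * w 0 j) • jetTensor (fun i => v i.succ) (fun i => w i.succ) n := by
  ext c
  simp only [contractFirst_apply, jetTensor, segreVec, line, Fin.prod_univ_succ, Fin.cons_zero,
    Fin.cons_succ, Pi.add_apply, Pi.smul_apply, smul_eq_mul, Finset.sum_mul,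
    ← Finset.sum_add_distrib, add_mul, coeff_add, coeff_C_mul, mul_assoc, coeff_X_mul]
  exact Finset.sum_congr rfl fun j _ => by ring

/-- Induction on the number of factors. Contracting with `φ` multiplies the coefficient of `T₂` by
`φ(v₀)`, so any `φ` with `φ(v₀) ≠ 0` that kills some summand reduces to one factor and one summand
fewer. -/
theorem le_card_add_one_of_jetTensor_eq_sum {S : Type*} : ∀ (k : ℕ) (v w : Fin k → Fin 2 → K)
    (_ : IsFrame v w) (a b c : K) (_ : c ≠ 0) (s : Finset S) (α : S → K)
    (u : S → Fin k → Fin 2 → K)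
    (_ : a • jetTensor v w 0 + b • jetTensor v w 1 + c • jetTensor v w 2 =
      ∑ x ∈ s, α x • segreVec (u x)), k ≤ s.card + 1
  | 0, _, _, _, _, _, _, _, _, _, _, _ => Nat.zero_le _
  | 1, _, _, _, _, _, _, _, _, _, _, _ => Nat.le_add_left _ _
  | k + 2, v, w, hvw, a, b, c, hc, s, α, u, h => by
    classical
    have hvw' : IsFrame (fun i : Fin (k + 1) => v i.succ) (fun i => w i.succ) := fun i => hvw i.succ
    have key : ∀ φ : Fin 2 → K, _ := fun φ => congrArg (contractFirst φ) h
    simp only [map_add, map_smul, map_sum, contractFirst_jetTensor_zero,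
      contractFirst_jetTensor_succ, contractFirst_segreVec] at key
    -- If all first factors were parallel to `v₀`, the form that kills `v₀` and is `1` on `w₀` would
    -- kill the right side and turn the left side into `b T₀ + c T₁` on the remaining factors, which
    -- is nonzero.
    have hex : ∃ x ∈ s, v 0 0 * u x 0 1 - v 0 1 * u x 0 0 ≠ 0 := by
      by_contra! hcon
      have h1 := key (dualSnd v w 0)
      rw [dualSnd_fst, hvw.dualSnd_snd, Finset.sum_eq_zero] at h1
      · have h2 := congrArg (pairing fun i => if i ∈ ({0} : Finset (Fin (k + 1))) then
          dualSnd (fun i : Fin (k + 1) => v i.succ) (fun i => w i.succ) i else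
          dualFst (fun i : Fin (k + 1) => v i.succ) (fun i => w i.succ) i) h1
        simp only [map_add, map_smul, hvw'.pairing_jetTensor] at h2
        simp [hc] at h2
      · intro x hx
        have : ∑ j, dualSnd v w 0 j * u x 0 j = 0 := by
          have := hcon x hx
          simp only [dualSnd, Fin.sum_univ_two, Pi.smul_apply, Matrix.cons_val_zero,
            Matrix.cons_val_one, smul_eq_mul]
          linear_combination (v 0 0 * w 0 1 - v 0 1 * w 0 0)⁻¹ * this
        rw [this, zero_smul, smul_zero]
    obtain ⟨x, hx, hne⟩ := hex
    have h1 := key ![u x 0 1, -u x 0 0]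
    rw [← Finset.add_sum_erase s _ hx] at h1
    have h0 : ∑ j, ![u x 0 1, -u x 0 0] j * u x 0 j = 0 := by simp [Fin.sum_univ_two]; ring
    rw [h0, zero_smul, smul_zero] at h1
    simp only [zero_add, one_add_one_eq_two] at h1
    have hd : ∑ j, ![u x 0 1, -u x 0 0] j * v 0 j ≠ 0 := by
      intro h'
      apply hne
      simp [Fin.sum_univ_two] at h'
      linear_combination h'
    set d := ∑ j, ![u x 0 1, -u x 0 0] j * v 0 j
    set e := ∑ j, ![u x 0 1, -u x 0 0] j * w 0 j
    have ih := le_card_add_one_of_jetTensor_eq_sum (k + 1) _ _ hvw' (a * d + b * e)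
      (b * d + c * e) (c * d) (mul_ne_zero hc hd) (s.erase x)
      (fun y => α y * ∑ j, ![u x 0 1, -u x 0 0] j * u y 0 j) (fun y i => u y i.succ) (by
        simp only [mul_smul]
        rw [← h1]
        module)
    rw [Finset.card_erase_of_mem hx] at ih
    have := Finset.card_pos.mpr ⟨x, hx⟩
    omega

end LowerBound

end MultiP1

namespace MultiP1

/-! ## The upper bound for the rank -/

section UpperBound

open Polynomial

variable {ι K : Type*} [Fintype ι] [Field K]

theorem natDegree_segreVec_line_le (v w : ι → Fin 2 → K) (c : ι → Fin 2) :
    (segreVec (line v w) c).natDegree ≤ Fintype.card ι := by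
  refine (natDegree_prod_le _ _).trans ?_
  rw [← Finset.card_univ, Finset.card_eq_sum_ones]
  refine Finset.sum_le_sum fun i _ => ?_
  rw [line]
  compute_degree

/-- The substitution `t = 1/x` exchanges `v` and `w`. In the parameter `x` the support of the jet
lies at infinity, so the finite parameters give the other points of the curve. -/
theorem reflect_segreVec_line (v w : ι → Fin 2 → K) (c : ι → Fin 2) :
    reflect (Fintype.card ι) (segreVec (line v w) c) = segreVec (line w v) c := by
  classical
  have hl : ∀ v w : ι → Fin 2 → K, ∀ i j, (line v w i j).natDegree ≤ 1 := by
    intro v w i j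
    rw [line]
    compute_degree
  have key : ∀ s : Finset ι, (∏ i ∈ s, line v w i (c i)).natDegree ≤ s.card ∧
      reflect s.card (∏ i ∈ s, line v w i (c i)) = ∏ i ∈ s, line w v i (c i) := by
    intro s
    induction s using Finset.induction_on with
    | empty => simp
    | insert i s hi ih =>
      rw [Finset.prod_insert hi, Finset.prod_insert hi, Finset.card_insert_of_notMem hi, add_comm]
      refine ⟨natDegree_mul_le.trans (add_le_add (hl _ _ _ _) ih.1), ?_⟩
      rw [reflect_mul _ _ (hl _ _ _ _) ih.1, ih.2]
      congr 1
      simp only [line, reflect_add, reflect_C, pow_one]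
      rw [mul_comm X, ← pow_one X, reflect_C_mul_X_pow]
      simp [revAt_le]
      ring
  exact (key Finset.univ).2

theorem jetTensor_apply_eq_coeff (v w : ι → Fin 2 → K) {n : ℕ} (hn : n ≤ Fintype.card ι)
    (c : ι → Fin 2) :
    jetTensor v w n c = (segreVec (line w v) c).coeff (Fintype.card ι - n) := by
  rw [← reflect_segreVec_line, coeff_reflect, revAt_le (Nat.sub_le _ _), Nat.sub_sub_self hn,
    jetTensor]

theorem eval_segreVec_line (v w : ι → Fin 2 → K) (x : K) (c : ι → Fin 2) :
    (segreVec (line w v) c).eval x = segreVec (fun i => w i + x • v i) c := by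
  simp only [segreVec, line, eval_prod, eval_add, eval_mul, eval_C, eval_X, Pi.add_apply,
    Pi.smul_apply, smul_eq_mul]

/-- A linear form on polynomials that vanishes on the multiples of `∏ (X - a)` is a combination of
the evaluations at the points `a`. -/
theorem linearMap_eq_sum_eval (s : Finset K) (ℓ : K[X] →ₗ[K] K) (k : ℕ)
    (hℓ : ∀ u : K[X], ((∏ a ∈ s, (X - C a)) * u).natDegree ≤ k → ℓ ((∏ a ∈ s, (X - C a)) * u) = 0)
    (hs : s.card ≤ k) :
    ∃ α : K → K, ∀ Q : K[X], Q.natDegree ≤ k → ℓ Q = ∑ a ∈ s, α a * Q.eval a := by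
  classical
  set h : K[X] := ∏ a ∈ s, (X - C a)
  have hm : h.Monic := monic_prod_of_monic _ _ fun a _ => monic_X_sub_C a
  have hd : h.natDegree = s.card := by simp [h, natDegree_prod_of_monic, monic_X_sub_C]
  refine ⟨fun a => ℓ (Lagrange.basis s id a), fun Q hQ => ?_⟩
  -- The remainder modulo `h` has degree below `s.card` and the same values as `Q` at the roots, so
  -- it is the Lagrange interpolant; `ℓ` sees only this remainder.
  have h1 : Q %ₘ h = Lagrange.interpolate s id fun a => Q.eval a := by
    refine Lagrange.eq_interpolate_of_eval_eq _ Function.injective_id.injOn ?_ fun a ha => ?_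
    · rw [← hd, ← degree_eq_natDegree hm.ne_zero]
      exact degree_modByMonic_lt _ hm
    · rw [id, modByMonic_eq_sub_mul_div, eval_sub, eval_mul,
        show h.eval a = 0 by
          rw [eval_prod]; exact Finset.prod_eq_zero ha (by simp), zero_mul, sub_zero]
  have h2 : (Q %ₘ h).natDegree ≤ k :=
    (natDegree_modByMonic_le _ hm).trans (hd.trans_le hs)
  have h3 : h * (Q /ₘ h) = Q - Q %ₘ h := by
    rw [eq_sub_iff_add_eq, add_comm, modByMonic_add_div]
  have h4 := hℓ (Q /ₘ h) (by rw [h3]; exact (natDegree_sub_le _ _).trans (max_le hQ h2))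
  rw [h3, map_sub, sub_eq_zero] at h4
  rw [h4, h1, Lagrange.interpolate_apply, map_sum]
  refine Finset.sum_congr rfl fun a _ => ?_
  rw [← smul_eq_C_mul, map_smul, smul_eq_mul, mul_comm]

/-- The linear form on binary forms of degree `k` given by `a • W₀ + b • W₁ + W₂`. -/
noncomputable def apolarForm (k : ℕ) (a b : K) : K[X] →ₗ[K] K :=
  a • lcoeff K k + b • lcoeff K (k - 1) + lcoeff K (k - 2)

/-- Each coordinate of `⊗ᵢ (wᵢ + X vᵢ)` is a polynomial of degree at most `k` whose coefficients in
degrees `k, k-1, k-2` are those of `T₀, T₁, T₂`. Writing `apolarForm` as evaluations at the roots of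
`h`, with weights independent of the coordinate, gives the decomposition. -/
theorem jetTensor_eq_sum_of_apolar [IsAlgClosed K] (v w : ι → Fin 2 → K) (hk : 2 ≤ Fintype.card ι)
    (a b : K) (h : K[X]) (hm : h.Monic) (hsep : h.Separable) (hdeg : h.natDegree ≤ Fintype.card ι)
    (hℓ : ∀ u : K[X], (h * u).natDegree ≤ Fintype.card ι →
      apolarForm (Fintype.card ι) a b (h * u) = 0) :
    ∃ (s : Finset K) (α : K → K), s.card = h.natDegree ∧
      a • jetTensor v w 0 + b • jetTensor v w 1 + jetTensor v w 2 =
        ∑ x ∈ s, α x • segreVec (fun i => w i + x • v i) := by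
  classical
  have hnd := nodup_roots hsep
  have hprod : ∏ x ∈ h.roots.toFinset, (X - C x) = h := by
    conv_rhs => rw [(IsAlgClosed.splits h).eq_prod_roots_of_monic hm]
    rw [Finset.prod, Multiset.toFinset_val, hnd.dedup]
  have hcard : h.roots.toFinset.card = h.natDegree := by
    rw [Multiset.toFinset_card_of_nodup hnd, ← (IsAlgClosed.splits h).natDegree_eq_card_roots]
  obtain ⟨α, hα⟩ := linearMap_eq_sum_eval h.roots.toFinset (apolarForm (Fintype.card ι) a b)
    (Fintype.card ι) (by rwa [hprod]) (by rwa [hcard])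
  refine ⟨_, α, hcard, funext fun c => ?_⟩
  have h1 := hα _ (natDegree_segreVec_line_le w v c)
  simp only [eval_segreVec_line] at h1
  rw [Finset.sum_apply]
  refine Eq.trans ?_ h1
  simp only [Pi.add_apply, Pi.smul_apply, apolarForm, LinearMap.add_apply, LinearMap.smul_apply,
    lcoeff_apply]
  rw [jetTensor_apply_eq_coeff v w (Nat.zero_le _), jetTensor_apply_eq_coeff v w (by omega),
    jetTensor_apply_eq_coeff v w hk, Nat.sub_zero]

/-- A multiple root of `f + c` is a root of `f'` at which `f` takes the value `-c`; only finitely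
many `c` arise this way. -/
theorem exists_separable_add_C [IsAlgClosed K] (f : K[X]) (hf : derivative f ≠ 0) :
    ∃ c : K, (f + C c).Separable := by
  classical
  obtain ⟨c, hc⟩ := Infinite.exists_notMem_finset
    ((derivative f).roots.toFinset.image fun r => -f.eval r)
  refine ⟨c, ?_⟩
  rw [Separable, derivative_add, derivative_C, add_zero]
  by_contra hcop
  obtain ⟨r, h1, h2⟩ : ∃ r, (f + C c).IsRoot r ∧ (derivative f).IsRoot r := by
    rw [Polynomial.isCoprime_iff_aeval_ne_zero_of_isAlgClosed K K] at hcop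
    push Not at hcop
    simpa using hcop
  refine hc (Finset.mem_image.mpr ⟨r, by simpa [hf] using h2, ?_⟩)
  simp [IsRoot] at h1
  linear_combination -h1

theorem exists_C_mul_X_add_C_of_natDegree_mul_le {h u : K[X]} (hm : h.Monic)
    (hu : (h * u).natDegree ≤ h.natDegree + 1) : ∃ x y, u = C x * X + C y := by
  refine exists_eq_X_add_C_of_natDegree_le_one ?_
  by_cases h0 : u = 0
  · simp [h0]
  · rw [natDegree_mul hm.ne_zero h0] at hu
    omega

/-- Here `k = n + 3` and `h` has degree `k - 1`, so the relevant multiples are spanned by `h` and `X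
h`. The conditions `b + h_{n+1} = 0` and `a + b h_{n+1} + h_n = 0` force the two prescribed
coefficients. -/
theorem apolarForm_mul_eq_zero {n : ℕ} {a b : K} {h : K[X]} (hm : h.Monic)
    (hdeg : h.natDegree = n + 2) (h1 : h.coeff (n + 1) = -b) (h0 : h.coeff n = b ^ 2 - a)
    (u : K[X]) (hu : (h * u).natDegree ≤ n + 3) : apolarForm (n + 3) a b (h * u) = 0 := by
  obtain ⟨x, y, rfl⟩ := exists_C_mul_X_add_C_of_natDegree_mul_le hm (by rwa [hdeg])
  have h2 : h.coeff (n + 2) = 1 := hdeg ▸ hm.coeff_natDegree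
  have h3 : h.coeff (n + 3) = 0 := coeff_eq_zero_of_natDegree_lt (by omega)
  rw [show h * (C x * X + C y) = C x * (h * X) + C y * h by ring]
  simp only [apolarForm, LinearMap.add_apply, LinearMap.smul_apply, lcoeff_apply, coeff_add,
    coeff_C_mul, smul_eq_mul, show n + 3 - 1 = n + 2 from rfl, show n + 3 - 2 = n + 1 from rfl,
    coeff_mul_X, h0, h1, h2, h3]
  ring

/-- With `k = n + 4` the constant term of `h` is unconstrained, so separability only requires a
nonzero derivative. For `k = 4` in characteristic 3, the case `b = e = 0` would give the inseparable
`X³ + c`. -/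
theorem exists_decomposition_of_four_le [IsAlgClosed K] (v w : ι → Fin 2 → K) {n : ℕ}
    (hcard : Fintype.card ι = n + 4) (hchar : n = 0 → (3 : K) ≠ 0) (a b : K) :
    ∃ (s : Finset K) (α : K → K), s.card = n + 3 ∧
      a • jetTensor v w 0 + b • jetTensor v w 1 + jetTensor v w 2 =
        ∑ x ∈ s, α x • segreVec (fun i => w i + x • v i) := by
  obtain ⟨e, he⟩ : ∃ e, b ^ 2 - a = e := ⟨_, rfl⟩
  -- For `n ≥ 1` the linear coefficient of `h` is also free, and setting it to `1` makes the
  -- derivative nonzero in every characteristic. For `n = 0` it is the prescribed coefficient `e`,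
  -- so nothing may be added.
  obtain ⟨d, hd0, hd1⟩ : ∃ d : K, (n = 0 → d = 0) ∧ (n ≠ 0 → d = 1) :=
    ⟨if n = 0 then 0 else 1, fun h => if_pos h, fun h => if_neg h⟩
  set f : K[X] := X ^ (n + 3) + (C (-b) * X ^ (n + 2) + C e * X ^ (n + 1) +
    C d * X) with hf
  have hlow : ∀ c : K, (C (-b) * X ^ (n + 2) + C e * X ^ (n + 1) +
    C d * X + C c : K[X]).degree < (n + 3 : ℕ) := by
    intro c
    refine lt_of_le_of_lt (b := ((n + 2 : ℕ) : WithBot ℕ)) ?_ (by exact_mod_cast Nat.lt_succ_self _)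
    rw [← natDegree_le_iff_degree_le]
    compute_degree
  have hder : derivative f ≠ 0 := by
    intro h0
    rcases Nat.eq_zero_or_pos n with rfl | hn
    · have := congrArg (fun p => coeff p 2) h0
      simp only [coeff_derivative, coeff_zero] at this
      simp [hf] at this
      exact hchar rfl (by linear_combination this)
    · have := congrArg (fun p => coeff p 0) h0
      simp only [coeff_derivative, coeff_zero] at this
      simp [hf, coeff_X_pow, hn.ne', hd1 hn.ne'] at this
  obtain ⟨c, hc⟩ := exists_separable_add_C f hder
  have hfc : f + C c = X ^ (n + 3) + (C (-b) * X ^ (n + 2) + C e * X ^ (n + 1) +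
    C d * X + C c) := by rw [hf]; ring
  have hm : (f + C c).Monic := hfc ▸ monic_X_pow_add (hlow c)
  have hdeg : (f + C c).natDegree = n + 3 := by
    rw [hfc, natDegree_add_eq_left_of_degree_lt, natDegree_X_pow]
    rw [degree_X_pow]
    exact hlow c
  have key := jetTensor_eq_sum_of_apolar v w (by omega) a b _ hm hc (by omega) <| by
    rw [hcard]
    refine apolarForm_mul_eq_zero hm hdeg ?_ ?_
    · simp [hfc, coeff_X_pow]
    · rw [he]
      rcases eq_or_ne n 0 with rfl | hn
      · simp [hfc, coeff_X_pow, hd0]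
      · simp [hfc, coeff_X_pow, coeff_C, hn]
  rwa [hdeg] at key

/-- For a cubic `h` only constant multiples matter, leaving the single condition `a + b h₂ + h₁ =
0`. The choice `h₂ = 1`, `h₁ = -(a + b)` meets it, and the derivative has coefficients `3` and `2`,
which cannot both vanish. -/
theorem exists_decomposition_of_card_eq_three [IsAlgClosed K] (v w : ι → Fin 2 → K)
    (hcard : Fintype.card ι = 3) (a b : K) :
    ∃ (s : Finset K) (α : K → K), s.card = 3 ∧
      a • jetTensor v w 0 + b • jetTensor v w 1 + jetTensor v w 2 =
        ∑ x ∈ s, α x • segreVec (fun i => w i + x • v i) := by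
  have hder : derivative (X ^ 3 + (X ^ 2 + C (-(a + b)) * X) : K[X]) ≠ 0 := by
    intro h0
    have h2 := congrArg (fun p => coeff p 2) h0
    have h1 := congrArg (fun p => coeff p 1) h0
    simp only [coeff_derivative, coeff_zero] at h1 h2
    simp [coeff_X_pow] at h1 h2
    exact one_ne_zero (α := K) (by linear_combination h2 - h1)
  obtain ⟨c, hc⟩ := exists_separable_add_C _ hder
  have hlow : (X ^ 2 + C (-(a + b)) * X + C c : K[X]).degree < (3 : ℕ) := by
    refine lt_of_le_of_lt (b := ((2 : ℕ) : WithBot ℕ)) ?_ (by norm_num)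
    rw [← natDegree_le_iff_degree_le]
    compute_degree
  rw [add_assoc] at hc
  have hm := monic_X_pow_add hlow
  have hdeg : (X ^ 3 + (X ^ 2 + C (-(a + b)) * X + C c) : K[X]).natDegree = 3 := by
    rw [natDegree_add_eq_left_of_degree_lt, natDegree_X_pow]
    rw [degree_X_pow]
    exact hlow
  have key := jetTensor_eq_sum_of_apolar v w (by omega) a b _ hm hc (by omega) <| by
    intro u hu
    obtain ⟨x, y, rfl⟩ :=
      exists_C_mul_X_add_C_of_natDegree_mul_le hm (hu.trans (by rw [hdeg, hcard]; norm_num))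
    have hx : x = 0 := by
      by_contra hx
      rw [hm.natDegree_mul' (by intro h; simpa [hx] using congrArg (fun p => coeff p 1) h), hdeg,
        hcard, natDegree_linear hx] at hu
      omega
    subst hx
    rw [hcard, map_zero, zero_mul, zero_add, mul_comm]
    simp only [apolarForm, LinearMap.add_apply, LinearMap.smul_apply, lcoeff_apply, coeff_C_mul]
    simp [coeff_C, coeff_X_pow]
    ring
  rwa [hdeg] at key

/-- The apolar quadric is `X² - bX + (b² - a)`, whose discriminant is `4a - 3b²`. -/
theorem exists_decomposition_of_discr_ne_zero [IsAlgClosed K] (v w : ι → Fin 2 → K)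
    (hcard : Fintype.card ι = 3) (a b : K) (hd : 4 * a - 3 * b ^ 2 ≠ 0) :
    ∃ (s : Finset K) (α : K → K), s.card = 2 ∧
      a • jetTensor v w 0 + b • jetTensor v w 1 + jetTensor v w 2 =
        ∑ x ∈ s, α x • segreVec (fun i => w i + x • v i) := by
  obtain ⟨e, he⟩ : ∃ e, b ^ 2 - a = e := ⟨_, rfl⟩
  obtain rfl : a = b ^ 2 - e := by rw [← he]; ring
  have hlow : (C (-b) * X + C e : K[X]).degree < (2 : ℕ) := by
    refine lt_of_le_of_lt (b := ((1 : ℕ) : WithBot ℕ)) ?_ (by norm_num)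
    rw [← natDegree_le_iff_degree_le]
    compute_degree
  have hm := monic_X_pow_add hlow
  have hdeg : (X ^ 2 + (C (-b) * X + C e) : K[X]).natDegree = 2 := by
    rw [natDegree_add_eq_left_of_degree_lt, natDegree_X_pow]
    rw [degree_X_pow]
    exact hlow
  have hsep : (X ^ 2 + (C (-b) * X + C e) : K[X]).Separable := by
    -- Bézout relation `h'² - 4h = b² - 4e`, divided by the discriminant; it is valid in every
    -- characteristic.
    refine ⟨C (-4 * (4 * (b ^ 2 - e) - 3 * b ^ 2)⁻¹),
      C ((4 * (b ^ 2 - e) - 3 * b ^ 2)⁻¹) * derivative (X ^ 2 + (C (-b) * X + C e)), ?_⟩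
    have : (C ((4 * (b ^ 2 - e) - 3 * b ^ 2)⁻¹) * C (4 * (b ^ 2 - e) - 3 * b ^ 2) : K[X]) = 1 := by
      rw [← C_mul, inv_mul_cancel₀ hd, C_1]
    rw [← this]
    simp only [derivative_add, derivative_X_pow, derivative_C, derivative_mul, derivative_X, map_mul,
      map_sub, map_neg, map_pow, map_ofNat, map_natCast]
    push_cast
    ring
  have key := jetTensor_eq_sum_of_apolar v w (by omega) (b ^ 2 - e) b _ hm hsep (by omega) <| by
    rw [hcard]
    refine apolarForm_mul_eq_zero (n := 0) hm hdeg ?_ ?_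
    · simp [coeff_C, coeff_X_pow]
    · simp [coeff_C, coeff_X_pow]
  rwa [hdeg] at key

end UpperBound

end MultiP1

namespace MultiP1

/-! ## The rank with respect to the Segre variety -/

section Rank

variable {ι K : Type*} [Fintype ι] [DecidableEq ι] [Field K]

theorem segre_submodule (q : Point ι K) :
    (segre q).submodule = K ∙ segreVec fun i => (q i).rep := by
  rw [segre, Projectivization.submodule_mk]
  rfl

/-- The points of `(ℙ¹)^ι` with given coordinate vectors. -/
noncomputable def Point.mk (u : ι → Fin 2 → K) (hu : ∀ i, u i ≠ 0) : Point ι K :=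
  fun i => Projectivization.mk K (u i) (hu i)

theorem segreVec_mem_segre_mk (u : ι → Fin 2 → K) (hu : ∀ i, u i ≠ 0) :
    segreVec u ∈ (segre (Point.mk u hu)).submodule := by
  choose a ha using fun i => Projectivization.exists_smul_eq_mk_rep K (u i) (hu i)
  rw [segre_submodule, Submodule.mem_span_singleton]
  refine ⟨∏ i, ((a i)⁻¹ : Kˣ), ?_⟩
  ext c
  simp only [segreVec, Point.mk, ← ha, Pi.smul_apply, Units.smul_def, smul_eq_mul,
    ← Finset.prod_mul_distrib]
  exact Finset.prod_congr rfl fun i _ => by simp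

theorem exists_finset_of_rep_eq_sum {S : Type*} (p : ℙ K (SegreCoords ι K)) (s : Finset S)
    (α : S → K) (u : S → ι → Fin 2 → K) (hu : ∀ x i, u x i ≠ 0)
    (h : p.rep = ∑ x ∈ s, α x • segreVec (u x)) :
    ∃ A : Finset (ℙ K (SegreCoords ι K)),
      (A : Set (ℙ K (SegreCoords ι K))) ⊆ Set.range (segre : Point ι K → _) ∧
      A.card ≤ s.card ∧ p.submodule ≤ ⨆ x ∈ A, x.submodule := by
  classical
  refine ⟨s.image fun x => segre (Point.mk (u x) (hu x)), ?_, Finset.card_image_le, ?_⟩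
  · intro y hy
    obtain ⟨x, -, rfl⟩ := Finset.mem_image.mp (Finset.mem_coe.mp hy)
    exact ⟨_, rfl⟩
  · rw [Projectivization.submodule_eq, Submodule.span_singleton_le_iff_mem, h]
    refine Submodule.sum_mem _ fun x hx => Submodule.smul_mem _ _ ?_
    exact Submodule.mem_iSup_of_mem _ (Submodule.mem_iSup_of_mem (Finset.mem_image_of_mem _ hx)
      (segreVec_mem_segre_mk (u x) (hu x)))

theorem segreRank_le_of_rep_eq_sum {S : Type*} (p : ℙ K (SegreCoords ι K)) (s : Finset S)
    (α : S → K) (u : S → ι → Fin 2 → K) (hu : ∀ x i, u x i ≠ 0)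
    (h : p.rep = ∑ x ∈ s, α x • segreVec (u x)) : segreRank p ≤ s.card := by
  obtain ⟨A, h1, h2, h3⟩ := exists_finset_of_rep_eq_sum p s α u hu h
  refine le_trans ?_ h2
  exact Nat.sInf_le ⟨A, h1, rfl, h3⟩

theorem exists_rep_eq_sum_of_submodule_le (p : ℙ K (SegreCoords ι K))
    (A : Finset (ℙ K (SegreCoords ι K)))
    (hA : (A : Set (ℙ K (SegreCoords ι K))) ⊆ Set.range (segre : Point ι K → _))
    (hp : p.submodule ≤ ⨆ x ∈ A, x.submodule) :
    ∃ (α : ℙ K (SegreCoords ι K) → K) (u : ℙ K (SegreCoords ι K) → ι → Fin 2 → K),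
      p.rep = ∑ x ∈ A, α x • segreVec (u x) := by
  classical
  have hmem : p.rep ∈ ⨆ x ∈ A, x.submodule := by
    apply hp
    rw [Projectivization.submodule_eq]
    exact Submodule.mem_span_singleton_self _
  obtain ⟨μ, hμ⟩ := (Submodule.mem_iSup_finset_iff_exists_sum _ _).mp hmem
  have : ∀ x : ℙ K (SegreCoords ι K), ∃ (a : K) (u : ι → Fin 2 → K), x ∈ A →
      a • segreVec u = (μ x : SegreCoords ι K) := by
    intro x
    by_cases hx : x ∈ A
    · obtain ⟨q, hq⟩ := hA hx
      subst hq
      obtain ⟨a, ha⟩ := Submodule.mem_span_singleton.mp ((segre_submodule q).le (μ (segre q)).2)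
      exact ⟨a, _, fun _ => ha⟩
    · exact ⟨0, 0, fun h => absurd h hx⟩
  choose α u hαu using this
  exact ⟨α, u, by rw [← hμ]; exact Finset.sum_congr rfl fun x hx => (hαu x hx).symm⟩

/-- One actual decomposition is required because the infimum of the empty set of naturals is `0`,
which would break a lower bound. -/
theorem le_segreRank_of_forall {S : Type*} (p : ℙ K (SegreCoords ι K)) (n : ℕ)
    (s : Finset S) (α : S → K) (u : S → ι → Fin 2 → K) (hu : ∀ x i, u x i ≠ 0)
    (h : p.rep = ∑ x ∈ s, α x • segreVec (u x))
    (hn : ∀ (A : Finset (ℙ K (SegreCoords ι K))) (α : ℙ K (SegreCoords ι K) → K)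
      (u : ℙ K (SegreCoords ι K) → ι → Fin 2 → K),
      p.rep = ∑ x ∈ A, α x • segreVec (u x) → n ≤ A.card) : n ≤ segreRank p := by
  obtain ⟨A, h1, -, h3⟩ := exists_finset_of_rep_eq_sum p s α u hu h
  refine le_csInf ⟨A.card, A, h1, rfl, h3⟩ ?_
  rintro _ ⟨A, h1, rfl, h3⟩
  obtain ⟨α, u, hA⟩ := exists_rep_eq_sum_of_submodule_le p A h1 h3
  exact hn A α u hA

end Rank

/-! ## The rank of the points of the osculating plane -/

section Osculating

variable {K : Type*} [Field K] {k : ℕ} {v w : Fin k → Fin 2 → K}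

theorem IsFrame.add_smul_ne_zero {ι : Type*} {v w : ι → Fin 2 → K} (h : IsFrame v w) (x : K)
    (i : ι) : w i + x • v i ≠ 0 := by
  intro h0
  have h1 := congrFun h0 0
  have h2 := congrFun h0 1
  simp at h1 h2
  apply h i
  linear_combination v i 0 * h2 - v i 1 * h1

theorem segreRank_le_of_decomposition (hvw : IsFrame v w) (p : ℙ K (SegreCoords (Fin k) K))
    {a b c : K} (hc : c ≠ 0)
    (hp : p.rep = a • jetTensor v w 0 + b • jetTensor v w 1 + c • jetTensor v w 2) {n : ℕ}
    (h : ∃ (s : Finset K) (α : K → K), s.card = n ∧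
      (a / c) • jetTensor v w 0 + (b / c) • jetTensor v w 1 + jetTensor v w 2 =
        ∑ x ∈ s, α x • segreVec (fun i => w i + x • v i)) :
    k - 1 ≤ segreRank p ∧ segreRank p ≤ n := by
  obtain ⟨s, α, rfl, h⟩ := h
  have hps : p.rep = ∑ x ∈ s, (c * α x) • segreVec (fun i => w i + x • v i) := by
    simp only [mul_smul]
    rw [← Finset.smul_sum, ← h, hp, smul_add, smul_add, smul_smul, smul_smul, mul_div_cancel₀ _ hc,
      mul_div_cancel₀ _ hc]
  refine ⟨le_segreRank_of_forall p _ s _ _ (fun x i => hvw.add_smul_ne_zero x i) hps ?_,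
    segreRank_le_of_rep_eq_sum p s _ _ (fun x i => hvw.add_smul_ne_zero x i) hps⟩
  intro A α u hA
  have := le_card_add_one_of_jetTensor_eq_sum k v w hvw a b c hc A α u (hp ▸ hA)
  omega

theorem segreRank_eq_of_four_le [IsAlgClosed K] (hvw : IsFrame v w) (hk : 4 ≤ k)
    (hchar : k = 4 → (3 : K) ≠ 0) (p : ℙ K (SegreCoords (Fin k) K)) {a b c : K} (hc : c ≠ 0)
    (hp : p.rep = a • jetTensor v w 0 + b • jetTensor v w 1 + c • jetTensor v w 2) :
    segreRank p = k - 1 := by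
  obtain ⟨n, rfl⟩ := Nat.exists_eq_add_of_le' hk
  have := segreRank_le_of_decomposition hvw p hc hp
    (exists_decomposition_of_four_le v w (n := n) (by simp) (fun h => hchar (by omega)) _ _)
  omega

theorem segreRank_mem_of_eq_three [IsAlgClosed K] (hvw : IsFrame v w) (hk : k = 3)
    (p : ℙ K (SegreCoords (Fin k) K)) {a b c : K} (hc : c ≠ 0)
    (hp : p.rep = a • jetTensor v w 0 + b • jetTensor v w 1 + c • jetTensor v w 2) :
    2 ≤ segreRank p ∧ segreRank p ≤ 3 := by
  have := segreRank_le_of_decomposition hvw p hc hp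
    (exists_decomposition_of_card_eq_three v w (by simp [hk]) _ _)
  omega

theorem segreRank_eq_two_of_discr_ne_zero [IsAlgClosed K] (hvw : IsFrame v w) (hk : k = 3)
    (p : ℙ K (SegreCoords (Fin k) K)) {a b c : K} (hc : c ≠ 0)
    (hd : 4 * a * c - 3 * b ^ 2 ≠ 0)
    (hp : p.rep = a • jetTensor v w 0 + b • jetTensor v w 1 + c • jetTensor v w 2) :
    segreRank p = 2 := by
  have := segreRank_le_of_decomposition hvw p hc hp
    (exists_decomposition_of_discr_ne_zero v w (by simp [hk]) _ _ (by
      intro h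
      apply hd
      field_simp at h
      linear_combination h))
  omega

/-! ### General points of the osculating plane for `k = 3`. -/

/-- The linear form on tensors with value `1` on the `n`-th tensor of the frame and `0` on the
others. -/
noncomputable def frameCoord (v w : Fin k → Fin 2 → K) (n : ℕ) : SegreCoords (Fin k) K →ₗ[K] K :=
  pairing fun i => if i ∈ Finset.univ.filter (fun i : Fin k => i.val < n) then dualSnd v w i
    else dualFst v w i

theorem IsFrame.frameCoord_jetTensor (hvw : IsFrame v w) {n : ℕ} (hn : n ≤ k) (m : ℕ) :
    frameCoord v w n (jetTensor v w m) = if m = n then 1 else 0 := by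
  rw [frameCoord, hvw.pairing_jetTensor, Fin.card_filter_val_lt, min_eq_right hn]

/-- The form defined by a linear form on `σ → K`. -/
noncomputable def linearForm {σ : Type*} [Fintype σ] [DecidableEq σ] (φ : (σ → K) →ₗ[K] K) :
    MvPolynomial σ K := ∑ c, MvPolynomial.C (φ (Pi.single c 1)) * MvPolynomial.X c

theorem linearForm_isHomogeneous {σ : Type*} [Fintype σ] [DecidableEq σ] (φ : (σ → K) →ₗ[K] K) :
    (linearForm φ).IsHomogeneous 1 :=
  MvPolynomial.IsHomogeneous.sum _ _ _ fun c _ => by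
    simpa using (MvPolynomial.isHomogeneous_C _ _).mul (MvPolynomial.isHomogeneous_X K c)

theorem eval_linearForm {σ : Type*} [Fintype σ] [DecidableEq σ] (φ : (σ → K) →ₗ[K] K)
    (x : σ → K) : MvPolynomial.eval x (linearForm φ) = φ x := by
  rw [LinearMap.pi_apply_eq_sum_univ φ x]
  simp only [linearForm, map_sum, map_mul, MvPolynomial.eval_C, MvPolynomial.eval_X, smul_eq_mul]
  refine Finset.sum_congr rfl fun i _ => ?_
  rw [mul_comm]
  congr 2
  ext j
  simp [Pi.single_apply, eq_comm]

theorem holdsGenerally_segreRank_eq_two [IsAlgClosed K] (hvw : IsFrame v w) (hk : k = 3)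
    (L : Submodule K (SegreCoords (Fin k) K))
    (hL : ∀ T, T ∈ L ↔ ∃ a b c : K,
      T = a • jetTensor v w 0 + b • jetTensor v w 1 + c • jetTensor v w 2) :
    HoldsGenerally L fun p => segreRank p = 2 := by
  set F := fun n => linearForm (frameCoord v w n)
  have hcoord : ∀ a b c : K,
      frameCoord v w 0 (a • jetTensor v w 0 + b • jetTensor v w 1 + c • jetTensor v w 2) = a ∧
      frameCoord v w 1 (a • jetTensor v w 0 + b • jetTensor v w 1 + c • jetTensor v w 2) = b ∧
      frameCoord v w 2 (a • jetTensor v w 0 + b • jetTensor v w 1 + c • jetTensor v w 2) = c := by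
    intro a b c
    simp only [map_add, map_smul, hvw.frameCoord_jetTensor (by omega : 0 ≤ k),
      hvw.frameCoord_jetTensor (by omega : 1 ≤ k), hvw.frameCoord_jetTensor (by omega : 2 ≤ k)]
    simp
  have hrep : ∀ p : ℙ K (SegreCoords (Fin k) K), p.submodule ≤ L ↔ p.rep ∈ L := by
    intro p
    rw [Projectivization.submodule_eq, Submodule.span_singleton_le_iff_mem]
  have hF1 : ∀ n, (F n).IsHomogeneous 1 := fun n => linearForm_isHomogeneous _
  have heval : ∀ x, MvPolynomial.eval x
      (F 2 * (MvPolynomial.C 4 * (F 0 * F 2) - MvPolynomial.C 3 * (F 1 * F 1))) =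
      frameCoord v w 2 x * (4 * (frameCoord v w 0 x * frameCoord v w 2 x) -
        3 * (frameCoord v w 1 x * frameCoord v w 1 x)) := by
    intro x
    simp only [F, map_mul, map_sub, MvPolynomial.eval_C, eval_linearForm]
  -- The factor `F 2` excludes `c = 0`; the other factor is the homogenized discriminant `4ac -
  -- 3b²`.
  refine ⟨1 + (0 + (1 + 1)),
    F 2 * (MvPolynomial.C 4 * (F 0 * F 2) - MvPolynomial.C 3 * (F 1 * F 1)), ?_, ?_, ?_⟩
  · exact (hF1 2).mul (((MvPolynomial.isHomogeneous_C _ _).mul ((hF1 0).mul (hF1 2))).sub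
      ((MvPolynomial.isHomogeneous_C _ _).mul ((hF1 1).mul (hF1 1))))
  -- The values `4` at `(1, 0)` and `-3` at `(0, 1)` add up to `1`, so one of them is nonzero in any
  -- characteristic.
  · obtain ⟨a, b, hab⟩ : ∃ a b : K, 4 * a - 3 * b ^ 2 ≠ 0 := by
      by_contra! h
      have h1 := h 1 0
      have h2 := h 0 1
      exact one_ne_zero (α := K) (by linear_combination h1 + h2)
    set T := a • jetTensor v w 0 + b • jetTensor v w 1 + (1 : K) • jetTensor v w 2 with hT
    have hT0 : T ≠ 0 := by
      intro h0
      have := (hcoord a b 1).2.2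
      rw [← hT, h0, map_zero] at this
      simp at this
    obtain ⟨t, ht⟩ := Projectivization.exists_smul_eq_mk_rep K T hT0
    refine ⟨Projectivization.mk K T hT0, ?_, ?_⟩
    · rw [hrep, ← ht]
      exact L.smul_mem _ ((hL _).mpr ⟨a, b, 1, hT⟩)
    · rw [heval, ← ht, Units.smul_def]
      simp only [map_smul, hT, hcoord a b 1]
      have : (t : K) ^ 3 * (4 * a - 3 * b ^ 2) ≠ 0 := mul_ne_zero (pow_ne_zero _ t.ne_zero) hab
      convert this using 1
      simp
      ring
  · intro p hp hne
    obtain ⟨a, b, c, habc⟩ := (hL _).mp ((hrep p).mp hp)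
    rw [heval, habc, (hcoord a b c).1, (hcoord a b c).2.1, (hcoord a b c).2.2] at hne
    simp at hne
    refine segreRank_eq_two_of_discr_ne_zero hvw hk p hne.1 ?_ habc
    intro h
    apply hne.2
    linear_combination h

end Osculating

end MultiP1

namespace MultiP1

/-! ## Multihomogeneous forms and ideals -/

section Forms

variable {ι K : Type*} [DecidableEq ι] [Field K]

theorem weight_mdeg_apply [Fintype ι] (m : ι × Fin 2 →₀ ℕ) (i : ι) :
    Finsupp.weight (mdeg ι) m i = ∑ j, m (i, j) := by
  rw [Finsupp.weight_apply, Finsupp.sum_fintype _ (fun v c => c • mdeg ι v) (fun _ => zero_smul _ _),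
    Fintype.sum_prod_type]
  simp [mdeg, Finset.sum_apply, Pi.single_apply, Finset.sum_add_distrib]

/-- Multihomogeneity with scalars in any `K`-algebra. It serves for formal variables `sᵢ`, for
dehomogenization, and for rescaling by units. -/
theorem aeval_mul_of_mem_forms [Fintype ι] {B : Type*} [CommSemiring B] [Algebra K B] {d : ι → ℕ}
    {f : MvPolynomial (ι × Fin 2) K} (hf : f ∈ forms ι K d) (c : ι → B) (x : ι × Fin 2 → B) :
    MvPolynomial.aeval (fun v => c v.1 * x v) f =
      (∏ i, c i ^ d i) * MvPolynomial.aeval x f := by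
  simp only [MvPolynomial.aeval_def, MvPolynomial.eval₂_eq', Finset.mul_sum]
  refine Finset.sum_congr rfl fun m hm => ?_
  have hd : Finsupp.weight (mdeg ι) m = d := hf (MvPolynomial.mem_support_iff.mp hm)
  have : ∏ v : ι × Fin 2, c v.1 ^ m v = ∏ i, c i ^ d i := by
    rw [Fintype.prod_prod_type]
    refine Finset.prod_congr rfl fun i _ => ?_
    dsimp only
    rw [Finset.prod_pow_eq_pow_sum, ← hd, weight_mdeg_apply]
  simp only [mul_pow, Finset.prod_mul_distrib, this]
  ring

theorem X_mem_forms (v : ι × Fin 2) :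
    (MvPolynomial.X v : MvPolynomial (ι × Fin 2) K) ∈ forms ι K (Pi.single v.1 1) :=
  MvPolynomial.isWeightedHomogeneous_X K (mdeg ι) v

theorem mul_mem_forms {d e : ι → ℕ} {f g : MvPolynomial (ι × Fin 2) K} (hf : f ∈ forms ι K d)
    (hg : g ∈ forms ι K e) : f * g ∈ forms ι K (d + e) :=
  MvPolynomial.IsWeightedHomogeneous.mul hf hg

theorem pow_mem_forms {d : ι → ℕ} {f : MvPolynomial (ι × Fin 2) K} (hf : f ∈ forms ι K d) (n : ℕ) :
    f ^ n ∈ forms ι K (n • d) :=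
  MvPolynomial.IsWeightedHomogeneous.pow hf n

theorem prod_mem_forms {S : Type*} (s : Finset S) (d : S → ι → ℕ)
    (f : S → MvPolynomial (ι × Fin 2) K) (hf : ∀ x ∈ s, f x ∈ forms ι K (d x)) :
    ∏ x ∈ s, f x ∈ forms ι K (∑ x ∈ s, d x) :=
  MvPolynomial.IsWeightedHomogeneous.prod s f d hf

theorem sum_single_smul [Fintype ι] (d : ι → ℕ) : ∑ i, d i • (Pi.single i 1 : ι → ℕ) = d := by
  ext j
  simp [Finset.sum_apply, Pi.single_apply]

theorem prod_X_mem_forms [Fintype ι] (c : ι → Fin 2) :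
    (∏ i, MvPolynomial.X (i, c i) : MvPolynomial (ι × Fin 2) K) ∈ forms ι K 1 := by
  convert prod_mem_forms (K := K) Finset.univ _ _ fun i _ => X_mem_forms (i, c i)
  convert (sum_single_smul (1 : ι → ℕ)).symm
  simp

theorem component_mem_forms (f : MvPolynomial (ι × Fin 2) K) (d : ι → ℕ) :
    MvPolynomial.weightedHomogeneousComponent (mdeg ι) d f ∈ forms ι K d :=
  MvPolynomial.weightedHomogeneousComponent_mem _ _ _

end Forms

namespace ClosedSubscheme

variable {ι K : Type*} [Fintype ι] [DecidableEq ι] [Field K]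

omit [Fintype ι] in
theorem mem_of_components_mem (I : Ideal (MvPolynomial (ι × Fin 2) K))
    (f : MvPolynomial (ι × Fin 2) K)
    (h : ∀ d : ι → ℕ, MvPolynomial.weightedHomogeneousComponent (mdeg ι) d f ∈ I) : f ∈ I := by
  rw [← MvPolynomial.sum_weightedHomogeneousComponent (mdeg ι) f]
  exact finsum_induction (· ∈ I) I.zero_mem (fun _ _ => I.add_mem) h

theorem ideal_le_of_forms (Γ Δ : ClosedSubscheme ι K)
    (h : ∀ d, ∀ f ∈ forms ι K d, f ∈ Γ.ideal → f ∈ Δ.ideal) : Γ.ideal ≤ Δ.ideal := fun f hf =>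
  mem_of_components_mem _ f fun d =>
    h d _ (component_mem_forms f d) (Γ.multihomogeneous f hf d)

/-- Multiplying by the monomials `∏ᵢ x_{i,c(i)}` raises the multidegree by `(1, …, 1)`, and
saturation of `Δ` undoes it; so large multidegrees suffice. -/
theorem ideal_le_of_forms_of_le (Γ Δ : ClosedSubscheme ι K) (D : ι → ℕ)
    (h : ∀ d ≥ D, ∀ f ∈ forms ι K d, f ∈ Γ.ideal → f ∈ Δ.ideal) : Γ.ideal ≤ Δ.ideal := by
  have key : ∀ m : ℕ, ∀ d : ι → ℕ, D ≤ d + m • (1 : ι → ℕ) →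
      ∀ f ∈ forms ι K d, f ∈ Γ.ideal → f ∈ Δ.ideal := by
    intro m
    induction m with
    | zero => exact fun d hd f hf => h d (by simpa using hd) f hf
    | succ m ih =>
      intro d hd f hf hfΓ
      refine Δ.saturated f fun c => ih (1 + d) ?_ _ (mul_mem_forms (prod_X_mem_forms c) hf)
        (Ideal.mul_mem_left _ _ hfΓ)
      refine hd.trans (le_of_eq ?_)
      rw [succ_nsmul']
      abel
  refine ideal_le_of_forms Γ Δ fun d => key (∑ i, D i) d fun i => ?_
  simp only [Pi.add_apply, Pi.smul_apply, Pi.one_apply, smul_eq_mul, mul_one]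
  exact (Finset.single_le_sum (fun _ _ => Nat.zero_le _) (Finset.mem_univ i)).trans
    (Nat.le_add_left _ _)

theorem hilbertFunction_eq_finrank_map {M : Type*} [AddCommGroup M] [Module K M]
    (Γ : ClosedSubscheme ι K) (d : ι → ℕ) (L : MvPolynomial (ι × Fin 2) K →ₗ[K] M)
    (hL : ∀ f ∈ forms ι K d, L f = 0 ↔ f ∈ Γ.ideal) :
    Γ.hilbertFunction d = Module.finrank K ((forms ι K d).map L) := by
  have h : (Γ.ideal.restrictScalars K).comap (forms ι K d).subtype =
      LinearMap.ker (L.domRestrict (forms ι K d)) := by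
    ext f
    simp [hL f f.2]
  rw [hilbertFunction, h, ← LinearMap.range_domRestrict]
  exact (L.domRestrict (forms ι K d)).quotKerEquivRange.finrank_eq

end ClosedSubscheme

/-! ## Jets of lines as subschemes -/

section Jets

open Polynomial

variable {ι K : Type*} [Field K]

/-- The restriction of forms to the line `t ↦ (vᵢ + t wᵢ)ᵢ`. -/
noncomputable def restrictLine (v w : ι → Fin 2 → K) : MvPolynomial (ι × Fin 2) K →ₐ[K] K[X] :=
  MvPolynomial.aeval fun x => line v w x.1 x.2

/-- The linear form `∑ⱼ ηⱼ x_{i,j}`. -/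
noncomputable def lin (i : ι) (η : Fin 2 → K) : MvPolynomial (ι × Fin 2) K :=
  ∑ j, MvPolynomial.C (η j) * MvPolynomial.X (i, j)

theorem lin_mem_forms [DecidableEq ι] (i : ι) (η : Fin 2 → K) :
    lin i η ∈ forms ι K (Pi.single i 1) :=
  Submodule.sum_mem _ fun j _ => by
    rw [← MvPolynomial.smul_eq_C_mul]
    exact Submodule.smul_mem _ _ (X_mem_forms (i, j))

theorem restrictLine_lin (v w : ι → Fin 2 → K) (i : ι) (η : Fin 2 → K) :
    restrictLine v w (lin i η) = C (∑ j, η j * v i j) + X * C (∑ j, η j * w i j) := by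
  simp only [restrictLine, lin, map_sum, map_mul, MvPolynomial.aeval_X, MvPolynomial.aeval_C, line,
    Finset.mul_sum, ← Finset.sum_add_distrib, algebraMap_eq]
  exact Finset.sum_congr rfl fun j _ => by ring

variable {v w : ι → Fin 2 → K}

theorem IsFrame.restrictLine_lin_dualFst (h : IsFrame v w) (i : ι) :
    restrictLine v w (lin i (dualFst v w i)) = 1 := by
  rw [restrictLine_lin, h.dualFst_fst, dualFst_snd]; simp

theorem IsFrame.restrictLine_lin_dualSnd (h : IsFrame v w) (i : ι) :
    restrictLine v w (lin i (dualSnd v w i)) = X := by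
  rw [restrictLine_lin, h.dualSnd_snd, dualSnd_fst]; simp

theorem IsFrame.exists_restrictLine_eq_X_pow [Fintype ι] [DecidableEq ι] (h : IsFrame v w)
    {d : ι → ℕ} (i : ι) {n : ℕ} (hn : n ≤ d i) : ∃ f ∈ forms ι K d, restrictLine v w f = X ^ n := by
  obtain ⟨e, rfl⟩ : ∃ e : ι → ℕ, d = n • Pi.single i 1 + e := by
    refine ⟨d - n • Pi.single i 1, (add_tsub_cancel_of_le fun j => ?_).symm⟩
    rcases eq_or_ne j i with rfl | hj
    · simpa using hn
    · simp [hj]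
  refine ⟨lin i (dualSnd v w i) ^ n * ∏ j, lin j (dualFst v w j) ^ e j, ?_, ?_⟩
  · have h1 := mul_mem_forms (pow_mem_forms (lin_mem_forms i (dualSnd v w i)) n)
      (prod_mem_forms Finset.univ _ _ fun j _ =>
        pow_mem_forms (lin_mem_forms j (dualFst v w j)) (e j))
    rwa [sum_single_smul] at h1
  · simp [h.restrictLine_lin_dualFst, h.restrictLine_lin_dualSnd]

theorem IsFrame.exists_restrictLine_sub_dvd [Fintype ι] [DecidableEq ι] (h : IsFrame v w)
    {d : ι → ℕ} (i : ι) {n : ℕ} (hn : n ≤ d i + 1) (p : K[X]) :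
    ∃ f ∈ forms ι K d, X ^ n ∣ restrictLine v w f - p := by
  have : ∀ j : ℕ, ∃ f ∈ forms ι K d, j < n → restrictLine v w f = X ^ j := by
    intro j
    by_cases hj : j < n
    · obtain ⟨f, hf, hj⟩ := h.exists_restrictLine_eq_X_pow (d := d) i (n := j) (by omega)
      exact ⟨f, hf, fun _ => hj⟩
    · exact ⟨0, Submodule.zero_mem _, fun h => absurd h hj⟩
  choose f hf hfX using this
  refine ⟨∑ j ∈ Finset.range n, p.coeff j • f j,
    Submodule.sum_mem _ fun j _ => Submodule.smul_mem _ _ (hf j), ?_⟩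
  rw [X_pow_dvd_iff]
  intro m hm
  rw [map_sum, coeff_sub, finsetSum_coeff, Finset.sum_congr rfl fun j hj => by
    rw [map_smul, hfX j (Finset.mem_range.mp hj), coeff_smul, coeff_X_pow]]
  simp [hm]

variable [Fintype ι] [DecidableEq ι]

/-- The homomorphism `x_{i,j} ↦ sᵢ (v_{i,j} + t w_{i,j})` to `(K[t]/tⁿ)[sᵢ]`. -/
noncomputable def jetHom (v w : ι → Fin 2 → K) (n : ℕ) :
    MvPolynomial (ι × Fin 2) K →ₐ[K] MvPolynomial ι (K[X] ⧸ Ideal.span {(X : K[X]) ^ n}) :=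
  MvPolynomial.aeval fun x => MvPolynomial.X x.1 *
    MvPolynomial.C (Ideal.Quotient.mk _ (line v w x.1 x.2))

theorem jetHom_of_mem_forms (v w : ι → Fin 2 → K) (n : ℕ) {d : ι → ℕ}
    {f : MvPolynomial (ι × Fin 2) K} (hf : f ∈ forms ι K d) :
    jetHom v w n f = (∏ i, MvPolynomial.X i ^ d i) *
      MvPolynomial.C (Ideal.Quotient.mk _ (restrictLine v w f)) := by
  rw [jetHom, aeval_mul_of_mem_forms hf (fun i => MvPolynomial.X i)
    fun x => MvPolynomial.C (Ideal.Quotient.mk _ (line v w x.1 x.2))]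
  congr 1
  have : (MvPolynomial.aeval fun x : ι × Fin 2 => MvPolynomial.C (σ := ι)
      (Ideal.Quotient.mk (Ideal.span {(X : K[X]) ^ n}) (line v w x.1 x.2))) =
      ((Algebra.ofId (K[X] ⧸ Ideal.span {(X : K[X]) ^ n}) (MvPolynomial ι _)).restrictScalars K).comp
      ((Ideal.Quotient.mkₐ K (Ideal.span {(X : K[X]) ^ n})).comp (restrictLine v w)) := by
    ext x
    simp [restrictLine, Algebra.ofId_apply, MvPolynomial.algebraMap_eq]
  rw [this]
  rfl

/-- The variables `sᵢ` record the multidegree, so the kernel is multihomogeneous and can be tested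
one component at a time. -/
theorem coeff_jetHom (v w : ι → Fin 2 → K) (n : ℕ) (f : MvPolynomial (ι × Fin 2) K)
    (d : ι →₀ ℕ) : MvPolynomial.coeff d (jetHom v w n f) = Ideal.Quotient.mk _
      (restrictLine v w (MvPolynomial.weightedHomogeneousComponent (mdeg ι) (d : ι → ℕ) f)) := by
  induction f using MvPolynomial.induction_on' with
  | add p q hp hq => simp only [map_add, MvPolynomial.coeff_add, hp, hq]
  | monomial u a =>
    have h1 := MvPolynomial.isWeightedHomogeneous_monomial (R := K) (mdeg ι) u a rfl
    have h2 : ∏ i, (MvPolynomial.X i : MvPolynomial ι (K[X] ⧸ Ideal.span {(X : K[X]) ^ n})) ^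
        Finsupp.weight (mdeg ι) u i =
        MvPolynomial.monomial (Finsupp.equivFunOnFinite.symm (Finsupp.weight (mdeg ι) u)) 1 := by
      rw [MvPolynomial.monomial_eq, MvPolynomial.C_1, one_mul, Finsupp.prod_fintype _ _ (by simp)]
      rfl
    rw [jetHom_of_mem_forms v w n h1, h2, mul_comm, MvPolynomial.coeff_C_mul,
      MvPolynomial.coeff_monomial]
    by_cases hd : Finsupp.weight (mdeg ι) u = d
    · rw [if_pos (by ext i; simp [hd]), mul_one, ← hd, h1.weightedHomogeneousComponent_same]
    · rw [if_neg (fun h => hd (by rw [← h]; rfl)), mul_zero,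
        h1.weightedHomogeneousComponent_ne _ (Ne.symm hd), map_zero, map_zero]

theorem jetHom_eq_zero_iff (v w : ι → Fin 2 → K) (n : ℕ) (f : MvPolynomial (ι × Fin 2) K) :
    jetHom v w n f = 0 ↔ ∀ d : ι → ℕ, X ^ n ∣
      restrictLine v w (MvPolynomial.weightedHomogeneousComponent (mdeg ι) d f) := by
  rw [MvPolynomial.ext_iff, Finsupp.equivFunOnFinite.forall_congr_left]
  refine forall_congr' fun d => ?_
  rw [coeff_jetHom, MvPolynomial.coeff_zero, Ideal.Quotient.eq_zero_iff_mem,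
    Ideal.mem_span_singleton]
  rfl

theorem jetHom_eq_zero_iff_of_mem_forms (v w : ι → Fin 2 → K) (n : ℕ) {d : ι → ℕ}
    {f : MvPolynomial (ι × Fin 2) K} (hf : f ∈ forms ι K d) :
    jetHom v w n f = 0 ↔ X ^ n ∣ restrictLine v w f := by
  rw [jetHom_eq_zero_iff]
  refine ⟨fun h => ?_, fun h e => ?_⟩
  · simpa [MvPolynomial.IsWeightedHomogeneous.weightedHomogeneousComponent_same hf] using h d
  · rcases eq_or_ne e d with rfl | he
    · rwa [MvPolynomial.IsWeightedHomogeneous.weightedHomogeneousComponent_same hf]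
    · rw [MvPolynomial.IsWeightedHomogeneous.weightedHomogeneousComponent_ne e hf he, map_zero]
      exact dvd_zero _

/-- The subscheme `tⁿ = 0` of the line `t ↦ (vᵢ + t wᵢ)ᵢ`. -/
noncomputable def jetScheme (v w : ι → Fin 2 → K) (h : IsFrame v w) (n : ℕ) :
    ClosedSubscheme ι K where
  ideal := RingHom.ker (jetHom v w n)
  multihomogeneous f hf d := by
    rw [RingHom.mem_ker] at hf ⊢
    rw [jetHom_eq_zero_iff_of_mem_forms v w n (component_mem_forms f d)]
    exact (jetHom_eq_zero_iff v w n f).mp hf d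
  saturated f hf := by
    -- The product expands into the monomials `∏ᵢ x_{i,c(i)}`. Each of its factors is `1` on the
    -- line, so it maps to `∏ᵢ sᵢ`, a nonzerodivisor.
    have h1 : (∏ i, lin i (dualFst v w i)) * f ∈ RingHom.ker (jetHom v w n) := by
      simp only [lin]
      rw [Finset.prod_univ_sum, Finset.sum_mul]
      refine Ideal.sum_mem _ fun c _ => ?_
      rw [Finset.prod_mul_distrib, mul_assoc]
      exact Ideal.mul_mem_left _ _ (hf c)
    rw [RingHom.mem_ker, map_mul, map_prod] at h1
    have h2 : ∀ i, jetHom v w n (lin i (dualFst v w i)) = MvPolynomial.X i := by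
      intro i
      rw [jetHom_of_mem_forms v w n (lin_mem_forms i _), h.restrictLine_lin_dualFst, map_one,
        map_one, mul_one, Finset.prod_eq_single i]
      · simp
      · intro j _ hj
        simp [hj]
      · simp
    simp only [h2] at h1
    exact ((MvPolynomial.isRegular_prod_X Finset.univ).left.mul_left_eq_zero_iff).mp h1

theorem mem_jetScheme_iff {h : IsFrame v w} {n : ℕ} {d : ι → ℕ} {f : MvPolynomial (ι × Fin 2) K}
    (hf : f ∈ forms ι K d) : f ∈ (jetScheme v w h n).ideal ↔ X ^ n ∣ restrictLine v w f :=
  jetHom_eq_zero_iff_of_mem_forms v w n hf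

theorem jetScheme_le_jetScheme (h : IsFrame v w) {m n : ℕ} (hmn : m ≤ n) :
    jetScheme v w h m ≤ jetScheme v w h n :=
  ClosedSubscheme.ideal_le_of_forms _ _ fun d f hf hfn => by
    rw [mem_jetScheme_iff hf] at hfn ⊢
    exact (pow_dvd_pow _ hmn).trans hfn

/-- Forms of multidegree `d` restrict to the line with every power `tʲ`, `j ≤ d i`, among their
values, so they reach all truncations modulo `tⁿ`. -/
theorem hilbertFunction_jetScheme (h : IsFrame v w) {n : ℕ} {d : ι → ℕ} (i : ι)
    (hn : n ≤ d i + 1) : (jetScheme v w h n).hilbertFunction d = n := by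
  set L : MvPolynomial (ι × Fin 2) K →ₗ[K] (Fin n → K) :=
    LinearMap.pi fun j => lcoeff K j ∘ₗ (restrictLine v w).toLinearMap with hL
  rw [ClosedSubscheme.hilbertFunction_eq_finrank_map _ d L]
  · have : (forms ι K d).map L = ⊤ := by
      rw [eq_top_iff]
      intro a _
      obtain ⟨f, hf, hfa⟩ := h.exists_restrictLine_sub_dvd (d := d) i hn
        (∑ j : Fin n, C (a j) * X ^ (j : ℕ))
      refine ⟨f, hf, funext fun j => ?_⟩
      have := X_pow_dvd_iff.mp hfa j j.2
      rw [coeff_sub, sub_eq_zero] at this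
      simp only [hL, LinearMap.pi_apply, LinearMap.comp_apply, AlgHom.toLinearMap_apply,
        lcoeff_apply, this, finsetSum_coeff, coeff_C_mul, coeff_X_pow, Fin.val_inj]
      simp
    rw [this, finrank_top, Module.finrank_fin_fun]
  · intro f hf
    rw [mem_jetScheme_iff hf, X_pow_dvd_iff, funext_iff]
    simp only [hL, LinearMap.pi_apply, LinearMap.comp_apply, AlgHom.toLinearMap_apply,
      lcoeff_apply, Pi.zero_apply, Fin.forall_iff]

theorem hasDegree_jetScheme [Nonempty ι] (h : IsFrame v w) (n : ℕ) :
    (jetScheme v w h n).HasDegree n :=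
  (Filter.eventually_ge_atTop fun _ => n).mono fun _ hd =>
    hilbertFunction_jetScheme h (Classical.arbitrary ι) ((hd _).trans (Nat.le_succ _))

end Jets

end MultiP1

namespace MultiP1

section JetSubschemes

open Polynomial

variable {ι K : Type*} [Field K] [Fintype ι] [DecidableEq ι] {v w : ι → Fin 2 → K}

/-! ## The subscheme of degree two of a jet of degree three -/

/-- Positivity of `finrank` supplies finite dimensionality; the surjection of quotients is then an
isomorphism. -/
theorem eq_of_le_of_finrank_quotient_eq {V : Type*} [AddCommGroup V] [Module K V]
    {P Q : Submodule K V} (hPQ : P ≤ Q) (h : Module.finrank K (V ⧸ P) = Module.finrank K (V ⧸ Q))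
    (h0 : 0 < Module.finrank K (V ⧸ P)) : P = Q := by
  have : FiniteDimensional K (V ⧸ P) := Module.finite_of_finrank_pos h0
  have : FiniteDimensional K (V ⧸ Q) := Module.finite_of_finrank_pos (h ▸ h0)
  have hinj := (LinearMap.injective_iff_surjective_of_finrank_eq_finrank h
    (f := Submodule.factor hPQ)).mpr (Submodule.factor_surjective hPQ)
  refine le_antisymm hPQ fun x hx => ?_
  have h3 : Submodule.factor hPQ (Submodule.Quotient.mk x) = 0 :=
    (Submodule.Quotient.mk_eq_zero Q).mpr hx
  rwa [map_eq_zero_iff _ hinj, Submodule.Quotient.mk_eq_zero] at h3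

/-- The ideals of `K[t]/t³` are the powers of `(t)`, so an element outside `(t²)` generates an ideal
containing `t`. -/
theorem exists_mul_sub_X_dvd {g : K[X]} (hg : ¬ X ^ 2 ∣ g) : ∃ q : K[X], X ^ 3 ∣ q * g - X := by
  by_cases h0 : g.coeff 0 = 0
  · have h1 : g.coeff 1 ≠ 0 := by
      intro h1
      apply hg
      rw [X_pow_dvd_iff]
      intro d hd
      interval_cases d <;> assumption
    refine ⟨C (g.coeff 1)⁻¹ - C ((g.coeff 1)⁻¹ ^ 2 * g.coeff 2) * X, ?_⟩
    rw [X_pow_dvd_iff]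
    intro d hd
    rw [sub_mul, mul_assoc, coeff_sub, coeff_sub, coeff_C_mul, coeff_C_mul]
    interval_cases d
    · simp [h0]
    · simp [coeff_X_mul, h0, h1]
    · simp only [coeff_X_mul, coeff_X]
      norm_num
      field_simp
      ring
  · refine ⟨C (g.coeff 0)⁻¹ * X - C ((g.coeff 0)⁻¹ ^ 2 * g.coeff 1) * X ^ 2, ?_⟩
    rw [X_pow_dvd_iff]
    intro d hd
    rw [sub_mul, mul_assoc, mul_assoc, coeff_sub, coeff_sub, coeff_C_mul, coeff_C_mul,
      coeff_X_pow_mul']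
    interval_cases d
    · simp
    · simp [coeff_X_mul, h0]
    · simp only [coeff_X_mul, coeff_X]
      norm_num
      field_simp
      ring

namespace ClosedSubscheme

/-- Otherwise the ideal of `β` contains `t` modulo `t³`, so in a larger multidegree it contains
every form vanishing at `t = 0`, and the Hilbert function drops to at most `1`. -/
theorem dvd_restrictLine_of_hilbertFunction_eq_two (h : IsFrame v w) (i : ι)
    (β : ClosedSubscheme ι K) (hβ : β ≤ jetScheme v w h 3) {D d : ι → ℕ}
    (hD : ∀ d ≥ D, β.hilbertFunction d = 2) (hd : D ≤ d) {f : MvPolynomial (ι × Fin 2) K}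
    (hf : f ∈ forms ι K d) (hfβ : f ∈ β.ideal) : X ^ 2 ∣ restrictLine v w f := by
  by_contra hdvd
  obtain ⟨q, hq⟩ := exists_mul_sub_X_dvd hdvd
  -- Degree `2` in one factor is enough to realize every class modulo `t³` by a form.
  set e : ι → ℕ := Pi.single i 2 with he
  have hei : e i = 2 := by simp [he]
  have hmem : ∀ g ∈ forms ι K (d + e), ∀ r : K[X],
      X ^ 3 ∣ restrictLine v w g - r * X → g ∈ β.ideal := by
    intro g hg r hr
    obtain ⟨m, hm, hmq⟩ := h.exists_restrictLine_sub_dvd (d := e) i (n := 3) (by omega) (r * q)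
    have h1 : f * m ∈ β.ideal := Ideal.mul_mem_right _ _ hfβ
    have h2 : g - f * m ∈ β.ideal := by
      refine hβ ((mem_jetScheme_iff (Submodule.sub_mem _ hg (mul_mem_forms hf hm))).mpr ?_)
      have := (hr.sub (hq.mul_left r)).sub (hmq.mul_left (restrictLine v w f))
      rw [map_sub, map_mul]
      convert this using 1
      ring
    simpa using Ideal.add_mem _ h2 h1
  obtain ⟨F, hF, hF0⟩ := h.exists_restrictLine_eq_X_pow (d := d + e) i (n := 0) (Nat.zero_le _)
  have hone : β.hilbertFunction (d + e) ≤ 1 := by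
    refine finrank_le_one (Submodule.Quotient.mk ⟨F, hF⟩) fun g => ?_
    obtain ⟨⟨g, hg⟩, rfl⟩ := Submodule.Quotient.mk_surjective _ g
    refine ⟨(restrictLine v w g).coeff 0, ?_⟩
    rw [← Submodule.Quotient.mk_smul, eq_comm, Submodule.Quotient.eq]
    refine hmem _ (Submodule.sub_mem _ hg (Submodule.smul_mem _ _ hF))
      (restrictLine v w g).divX ?_
    change X ^ 3 ∣ restrictLine v w (g - (restrictLine v w g).coeff 0 • F) - _
    rw [map_sub, map_smul, hF0, pow_zero]
    have := divX_mul_X_add (restrictLine v w g)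
    rw [smul_eq_C_mul, mul_one, ← eq_sub_iff_add_eq.mpr this, sub_self]
    exact dvd_zero _
  have := hD (d + e) (hd.trans (le_add_of_nonneg_right (zero_le)))
  omega

theorem eq_jetScheme_two (h : IsFrame v w) (i : ι) (β : ClosedSubscheme ι K)
    (hβ : β ≤ jetScheme v w h 3) (hdeg : β.HasDegree 2) : β = jetScheme v w h 2 := by
  obtain ⟨D, hD⟩ := Filter.eventually_atTop.mp hdeg
  have key : ∀ d ≥ D ⊔ Pi.single i 1, ∀ f ∈ forms ι K d,
      f ∈ β.ideal ↔ f ∈ (jetScheme v w h 2).ideal := by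
    intro d hd f hf
    have hdi : 1 ≤ d i := by simpa using (le_sup_right.trans hd : Pi.single i 1 ≤ d) i
    set P := (β.ideal.restrictScalars K).comap (forms ι K d).subtype with hP
    set Q := ((jetScheme v w h 2).ideal.restrictScalars K).comap (forms ι K d).subtype with hQ
    have hPQ : P ≤ Q := fun x hx => (mem_jetScheme_iff (h := h) x.2).mpr
      (dvd_restrictLine_of_hilbertFunction_eq_two h i β hβ hD (le_sup_left.trans hd) x.2 hx)
    have h1 : Module.finrank K (forms ι K d ⧸ P) = 2 := hD d (le_sup_left.trans hd)
    have h2 : Module.finrank K (forms ι K d ⧸ Q) = 2 := hilbertFunction_jetScheme h i (by omega)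
    have hPQ' := eq_of_le_of_finrank_quotient_eq hPQ (h1.trans h2.symm) (by omega)
    exact ⟨fun hfβ => hPQ (x := ⟨f, hf⟩) hfβ, fun hfJ => hPQ'.ge (x := ⟨f, hf⟩) hfJ⟩
  exact ClosedSubscheme.ext (le_antisymm
    (ideal_le_of_forms_of_le _ _ _ fun d hd f hf => (key d hd f hf).mp)
    (ideal_le_of_forms_of_le _ _ _ fun d hd f hf => (key d hd f hf).mpr))

end ClosedSubscheme

/-! ## The linear span of a jet -/

theorem pullback_mem_forms (φ : Module.Dual K (SegreCoords ι K)) :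
    pullback φ ∈ forms ι K 1 :=
  Submodule.sum_mem _ fun c _ => by
    rw [← MvPolynomial.smul_eq_C_mul]
    exact Submodule.smul_mem _ _ (prod_X_mem_forms c)

theorem coeff_restrictLine_pullback (v w : ι → Fin 2 → K) (φ : Module.Dual K (SegreCoords ι K))
    (n : ℕ) : (restrictLine v w (pullback φ)).coeff n = φ (jetTensor v w n) := by
  simp only [pullback, restrictLine, map_sum, map_mul, map_prod, MvPolynomial.aeval_X,
    MvPolynomial.aeval_C, algebraMap_eq, finsetSum_coeff, coeff_C_mul]
  rw [LinearMap.pi_apply_eq_sum_univ φ (jetTensor v w n)]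
  refine Finset.sum_congr rfl fun c _ => ?_
  rw [smul_eq_mul, mul_comm, jetTensor, segreVec]
  congr 2
  ext j
  simp [Pi.single_apply, eq_comm]

/-- The restriction of `pullback φ` to the line has coefficients `φ(Tⱼ)`, so the hyperplanes through
the jet are exactly those through `T₀, …, T_{n-1}`. -/
theorem segreSpan_jetScheme (h : IsFrame v w) (n : ℕ) :
    segreSpan (jetScheme v w h n) =
      Submodule.span K (Set.range fun j : Fin n => jetTensor v w j) := by
  have hmem : ∀ φ, pullback φ ∈ (jetScheme v w h n).ideal ↔
      ∀ j < n, φ (jetTensor v w j) = 0 := by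
    intro φ
    simp only [mem_jetScheme_iff (pullback_mem_forms φ), X_pow_dvd_iff,
      coeff_restrictLine_pullback]
  refine le_antisymm (fun T hT => ?_) ?_
  · by_contra hT'
    obtain ⟨φ, hφT, hφ⟩ := Submodule.exists_le_ker_of_notMem hT'
    rw [segreSpan, Submodule.mem_iInf] at hT
    have := hT φ
    rw [Submodule.mem_iInf] at this
    refine hφT (this ((hmem φ).mpr fun j hj => ?_))
    exact hφ (Submodule.subset_span ⟨⟨j, hj⟩, rfl⟩)
  · rw [Submodule.span_le]
    rintro _ ⟨j, rfl⟩
    simp only [segreSpan, SetLike.mem_coe, Submodule.mem_iInf, LinearMap.mem_ker]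
    exact fun φ hφ => (hmem φ).mp hφ j j.2

theorem mem_segreSpan_jetScheme_three (h : IsFrame v w) (T : SegreCoords ι K) :
    T ∈ segreSpan (jetScheme v w h 3) ↔ ∃ a b c : K,
      T = a • jetTensor v w 0 + b • jetTensor v w 1 + c • jetTensor v w 2 := by
  rw [segreSpan_jetScheme, Submodule.mem_span_range_iff_exists_fun]
  constructor
  · rintro ⟨α, rfl⟩
    exact ⟨α 0, α 1, α 2, by simp [Fin.sum_univ_three]⟩
  · rintro ⟨a, b, c, rfl⟩
    exact ⟨![a, b, c], by simp [Fin.sum_univ_three]⟩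

theorem mem_segreSpan_jetScheme_two (h : IsFrame v w) (a b : K) :
    a • jetTensor v w 0 + b • jetTensor v w 1 ∈ segreSpan (jetScheme v w h 2) := by
  rw [segreSpan_jetScheme, Submodule.mem_span_range_iff_exists_fun]
  exact ⟨![a, b], by simp⟩

end JetSubschemes

end MultiP1

namespace MultiP1

universe u₁ u₂

/-! ## The coordinate algebra of a zero-dimensional subscheme -/

section CoordinateAlgebra

variable {ι : Type u₁} {K : Type u₂} [Fintype ι] [DecidableEq ι] [Field K]

namespace ClosedSubscheme

theorem X_mul_mem_imp_mem (Γ : ClosedSubscheme ι K) (i : ι) (f : MvPolynomial (ι × Fin 2) K)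
    (h : ∀ j, MvPolynomial.X (i, j) * f ∈ Γ.ideal) : f ∈ Γ.ideal := by
  refine Γ.saturated f fun c => ?_
  rw [← Finset.mul_prod_erase Finset.univ _ (Finset.mem_univ i), mul_comm (MvPolynomial.X _),
    mul_assoc]
  exact Ideal.mul_mem_left _ _ (h _)

/-- Prime avoidance over the finitely many associated primes. One containing these forms for two
values of `a` would contain both `x_{i,0}` and `x_{i,1}`; being the annihilator of some `f`, it
would force `f` into the saturated ideal. -/
theorem exists_lin_mem_nonZeroDivisors [Infinite K] (Γ : ClosedSubscheme ι K) (i : ι) :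
    ∃ a : K, Ideal.Quotient.mk Γ.ideal (lin i ![1, a]) ∈
      nonZeroDivisors (MvPolynomial (ι × Fin 2) K ⧸ Γ.ideal) := by
  set A := MvPolynomial (ι × Fin 2) K ⧸ Γ.ideal
  have hfin := associatedPrimes.finite A A
  have hbad : ∀ P ∈ associatedPrimes A A,
      {a : K | Ideal.Quotient.mk Γ.ideal (lin i ![1, a]) ∈ P}.Subsingleton := by
    intro P hP a ha b hb
    by_contra hab
    obtain ⟨hprime, x, hx⟩ := isAssociatedPrime_iff.mp hP
    have h1 : Ideal.Quotient.mk Γ.ideal (MvPolynomial.X (i, 1)) ∈ P := by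
      have := P.mul_mem_left (Ideal.Quotient.mk Γ.ideal (MvPolynomial.C (a - b)⁻¹))
        (P.sub_mem ha hb)
      rw [← map_sub, ← map_mul] at this
      convert this using 2
      have h2 : (MvPolynomial.C (a - b)⁻¹ * (MvPolynomial.C a - MvPolynomial.C b) :
          MvPolynomial (ι × Fin 2) K) = 1 := by
        rw [← map_sub, ← map_mul, inv_mul_cancel₀ (sub_ne_zero.mpr hab), map_one]
      simp only [lin, Fin.sum_univ_two, Matrix.cons_val_zero, Matrix.cons_val_one]
      linear_combination -(MvPolynomial.X (i, 1)) * h2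
    have h0 : Ideal.Quotient.mk Γ.ideal (MvPolynomial.X (i, 0)) ∈ P := by
      have := P.sub_mem ha (P.mul_mem_left (Ideal.Quotient.mk Γ.ideal (MvPolynomial.C a)) h1)
      rw [← map_mul, ← map_sub] at this
      convert this using 2
      simp [lin, Fin.sum_univ_two]
    obtain ⟨f, rfl⟩ := Ideal.Quotient.mk_surjective x
    apply hprime.ne_top
    rw [hx, Ideal.eq_top_iff_one, Submodule.mem_colon_singleton, one_smul, Submodule.mem_bot,
      Ideal.Quotient.eq_zero_iff_mem]
    refine Γ.X_mul_mem_imp_mem i f fun j => ?_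
    rw [← Ideal.Quotient.eq_zero_iff_mem, map_mul]
    have hj : Ideal.Quotient.mk Γ.ideal (MvPolynomial.X (i, j)) ∈ P := by
      fin_cases j
      · exact h0
      · exact h1
    rw [hx, Submodule.mem_colon_singleton, Submodule.mem_bot] at hj
    exact hj
  obtain ⟨a, ha⟩ := (hfin.biUnion fun P hP => (hbad P hP).finite).exists_notMem
  refine ⟨a, ?_⟩
  have h := biUnion_associatedPrimes_eq_compl_nonZeroDivisors A
  by_contra hcon
  have h2 : Ideal.Quotient.mk Γ.ideal (lin i ![1, a]) ∈ ⋃ p ∈ associatedPrimes A A, (p : Set A) :=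
    h ▸ hcon
  apply ha
  simpa using h2

/-- `ψ` is the quotient map onto the algebra of regular functions on the part of `Γ` where none of
the linear forms `x_{i,0} + aᵢ x_{i,1}` vanishes, and no form that vanishes there is lost: `ψ`
restricted to forms has the ideal of `Γ` as kernel. -/
structure IsCoordinateHom (Γ : ClosedSubscheme ι K) {B : Type*} [CommRing B] [Algebra K B]
    (a : ι → K) (ψ : MvPolynomial (ι × Fin 2) K →ₐ[K] B) : Prop where
  map_lin : ∀ i, ψ (lin i ![1, a i]) = 1
  map_eq_zero_iff : ∀ d, ∀ f ∈ forms ι K d, ψ f = 0 ↔ f ∈ Γ.ideal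
  surjective : Function.Surjective ψ

theorem exists_isCoordinateHom [Infinite K] (Γ : ClosedSubscheme ι K) :
    ∃ (B : Type (max u₁ u₂)) (_ : CommRing B) (_ : Algebra K B) (a : ι → K)
      (ψ : MvPolynomial (ι × Fin 2) K →ₐ[K] B), Γ.IsCoordinateHom a ψ := by
  choose a ha using Γ.exists_lin_mem_nonZeroDivisors
  set A := MvPolynomial (ι × Fin 2) K ⧸ Γ.ideal
  set B := FractionRing A
  have hunit : ∀ i, IsUnit (algebraMap A B (Ideal.Quotient.mk Γ.ideal (lin i ![1, a i]))) :=
    fun i => IsLocalization.map_units B (⟨_, ha i⟩ : nonZeroDivisors A)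
  choose c hc using hunit
  -- Dehomogenization `x_{i,j} ↦ x_{i,j} / lᵢ` in the total ring of fractions; on forms it differs
  -- from the quotient map by a unit.
  set ψ : MvPolynomial (ι × Fin 2) K →ₐ[K] B := MvPolynomial.aeval fun v =>
    ((c v.1)⁻¹ : Bˣ) * algebraMap A B (Ideal.Quotient.mk Γ.ideal (MvPolynomial.X v)) with hψ
  have hform : ∀ d, ∀ f ∈ forms ι K d, ψ f =
      (∏ i, (((c i)⁻¹ : Bˣ) : B) ^ d i) * algebraMap A B (Ideal.Quotient.mk Γ.ideal f) := by
    intro d f hf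
    rw [hψ, aeval_mul_of_mem_forms hf (fun i => (((c i)⁻¹ : Bˣ) : B))]
    congr 1
    have : (MvPolynomial.aeval fun v : ι × Fin 2 =>
        algebraMap A B (Ideal.Quotient.mk Γ.ideal (MvPolynomial.X v))) =
        (IsScalarTower.toAlgHom K A B).comp (Ideal.Quotient.mkₐ K Γ.ideal) := by
      ext v
      simp
      rfl
    rw [this]
    rfl
  refine ⟨ψ.range, inferInstance, inferInstance, a, ψ.rangeRestrict, ?_, ?_,
    ψ.rangeRestrict_surjective⟩
  · intro i
    ext
    rw [AlgHom.coe_codRestrict, hform _ _ (lin_mem_forms i _), Finset.prod_eq_single i]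
    · rw [Pi.single_eq_same, pow_one, ← hc, Units.inv_mul]
      rfl
    · intro j _ hj
      simp [hj]
    · simp
  · intro d f hf
    rw [← Subtype.coe_inj, AlgHom.coe_codRestrict, hform d f hf, ← Ideal.Quotient.eq_zero_iff_mem]
    have hu : IsUnit (∏ i, (((c i)⁻¹ : Bˣ) : B) ^ d i) := by
      simp only [← Units.val_pow_eq_pow_val, ← Units.coe_prod]
      exact Units.isUnit _
    rw [ZeroMemClass.coe_zero, hu.mul_right_eq_zero,
      map_eq_zero_iff _ (IsFractionRing.injective A B)]

namespace IsCoordinateHom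

variable {Γ : ClosedSubscheme ι K} {B : Type*} [CommRing B] [Algebra K B] {a : ι → K}
  {ψ : MvPolynomial (ι × Fin 2) K →ₐ[K] B} (h : Γ.IsCoordinateHom a ψ)
include h

theorem map_forms_mono {d e : ι → ℕ} (hde : d ≤ e) :
    (forms ι K d).map ψ.toLinearMap ≤ (forms ι K e).map ψ.toLinearMap := by
  rintro _ ⟨f, hf, rfl⟩
  obtain ⟨e, rfl⟩ := exists_add_of_le hde
  refine ⟨f * ∏ i, lin i ![1, a i] ^ e i, mul_mem_forms hf ?_, ?_⟩
  · have := prod_mem_forms Finset.univ _ _ fun j _ =>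
      pow_mem_forms (lin_mem_forms (K := K) j ![1, a j]) (e j)
    rwa [sum_single_smul] at this
  · simp [h.map_lin]

theorem finrank_map_forms (d : ι → ℕ) :
    Module.finrank K ((forms ι K d).map ψ.toLinearMap) = Γ.hilbertFunction d :=
  (Γ.hilbertFunction_eq_finrank_map d ψ.toLinearMap (h.map_eq_zero_iff d)).symm

/-- The images of the forms grow with `d`, since the `lᵢ` map to `1`, and their dimension is the
Hilbert function. They stabilize in dimension `n` and exhaust `B`. -/
theorem finrank_eq {n : ℕ} [NeZero n] (hn : Γ.HasDegree n) : Module.finrank K B = n := by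
  obtain ⟨D, hD⟩ := Filter.eventually_atTop.mp hn
  have hle : ∀ d, (forms ι K d).map ψ.toLinearMap ≤ (forms ι K D).map ψ.toLinearMap := by
    intro d
    have hfr := (h.finrank_map_forms (d ⊔ D)).trans (hD _ le_sup_right)
    have : FiniteDimensional K ((forms ι K (d ⊔ D)).map ψ.toLinearMap) :=
      Module.finite_of_finrank_pos (hfr ▸ NeZero.pos n)
    rw [Submodule.eq_of_le_of_finrank_eq (h.map_forms_mono (le_sup_right : D ≤ d ⊔ D))
      (((h.finrank_map_forms D).trans (hD D le_rfl)).trans hfr.symm)]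
    exact h.map_forms_mono le_sup_left
  have htop : (forms ι K D).map ψ.toLinearMap = ⊤ := by
    rw [eq_top_iff]
    intro b _
    obtain ⟨f, rfl⟩ := h.surjective b
    rw [← MvPolynomial.sum_weightedHomogeneousComponent (mdeg ι) f]
    rw [← AlgHom.toLinearMap_apply]
    refine finsum_induction (fun g => ψ.toLinearMap g ∈ (forms ι K D).map ψ.toLinearMap) ?_ ?_ ?_
    · rw [map_zero]; exact Submodule.zero_mem _
    · intro x y hx hy
      rw [map_add]
      exact Submodule.add_mem _ hx hy
    · exact fun d => hle d ⟨_, component_mem_forms f d, rfl⟩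
  rw [← hD D le_rfl, ← h.finrank_map_forms D, htop, finrank_top]

/-- The Hilbert function of `Γ.image i` measures the part of `B` coming from the `i`-th factor; if
it reaches `dim B`, that factor alone generates `B`. -/
theorem exists_rename_eq [FiniteDimensional K B] (i : ι)
    (hi : (Γ.image i).HasDegree (Module.finrank K B)) (b : B) :
    ∃ g, ψ (MvPolynomial.rename (fun v : Unit × Fin 2 => (i, v.2)) g) = b := by
  obtain ⟨D, hD⟩ := hi.exists
  set L := ψ.toLinearMap ∘ₗ
    (MvPolynomial.rename (R := K) fun v : Unit × Fin 2 => (i, v.2)).toLinearMap with hL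
  have hrename : ∀ f ∈ forms Unit K D, MvPolynomial.rename (fun v : Unit × Fin 2 => (i, v.2)) f ∈
      forms ι K (Pi.single i (D ())) := by
    intro f hf
    rw [← MvPolynomial.IsWeightedHomogeneous.weightedHomogeneousComponent_same hf,
      rename_component]
    exact component_mem_forms _ _
  rw [hilbertFunction_eq_finrank_map _ D L] at hD
  · have htop := Submodule.eq_top_of_finrank_eq hD
    obtain ⟨g, -, hg⟩ : b ∈ (forms Unit K D).map L := htop ▸ Submodule.mem_top
    exact ⟨g, hg⟩
  · intro f hf
    rw [hL, LinearMap.comp_apply, AlgHom.toLinearMap_apply, AlgHom.toLinearMap_apply,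
      h.map_eq_zero_iff _ _ (hrename f hf)]
    rfl

end IsCoordinateHom

end ClosedSubscheme

end CoordinateAlgebra

end MultiP1

namespace MultiP1

universe u₁ u₂

section Support

variable {ι : Type u₁} {K : Type u₂} [Fintype ι] [DecidableEq ι] [Field K]

/-! ## The support of a zero-dimensional subscheme -/

omit [Fintype ι] [DecidableEq ι] in
theorem eval_lin (x : ι × Fin 2 → K) (i : ι) (η : Fin 2 → K) :
    MvPolynomial.eval x (lin i η) = η 0 * x (i, 0) + η 1 * x (i, 1) := by
  simp [lin, Fin.sum_univ_two]

omit [Fintype ι] [DecidableEq ι] in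
theorem Point.apply_eq_of_smul {q r : Point ι K} {i : ι} {c : K}
    (h : ∀ j, q.coords (i, j) = c * r.coords (i, j)) : q i = r i := by
  rw [← (q i).mk_rep, ← (r i).mk_rep, Projectivization.mk_eq_mk_iff']
  exact ⟨c, funext fun j => (h j).symm⟩

omit [Fintype ι] [DecidableEq ι] in
theorem Point.exists_coords_mk (u : ι → Fin 2 → K) (hu : ∀ i, u i ≠ 0) :
    ∃ c : ι → Kˣ, ∀ v, (Point.mk u hu).coords v = c v.1 * u v.1 v.2 := by
  choose c hc using fun i => Projectivization.exists_smul_eq_mk_rep K (u i) (hu i)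
  exact ⟨c, fun v => (congrFun (hc v.1) v.2).symm⟩

omit [Fintype ι] in
-- This makes a finite connected support a single point. Points differing in the `i`-th factor are
-- separated by the linear form vanishing at one of them.
instance : T1Space (Point ι K) := by
  rw [t1Space_iff_exists_open]
  intro q r hqr
  obtain ⟨i, hi⟩ := Function.ne_iff.mp hqr
  refine ⟨{p | MvPolynomial.eval p.coords (lin i ![r.coords (i, 1), -r.coords (i, 0)]) ≠ 0},
    TopologicalSpace.isOpen_generateFrom_of_mem ⟨_, _, lin_mem_forms i _, rfl⟩, ?_, ?_⟩
  · intro h0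
    apply hi
    simp only [eval_lin, Matrix.cons_val_zero, Matrix.cons_val_one] at h0
    have hr : ∃ j, r.coords (i, j) ≠ 0 := Function.ne_iff.mp (r i).rep_nonzero
    rw [Fin.exists_fin_two] at hr
    by_cases hr0 : r.coords (i, 0) = 0
    · have hr1 : r.coords (i, 1) ≠ 0 := by tauto
      have hq0 : q.coords (i, 0) = 0 := by simpa [hr0, hr1] using h0
      refine Point.apply_eq_of_smul (c := q.coords (i, 1) / r.coords (i, 1)) (Fin.forall_fin_two.mpr ⟨by simp [hr0, hq0], by field_simp⟩)
    · refine Point.apply_eq_of_smul (c := q.coords (i, 0) / r.coords (i, 0)) (Fin.forall_fin_two.mpr ⟨by field_simp, ?_⟩)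
      field_simp
      linear_combination -h0
  · simp [eval_lin, mul_comm]

namespace ClosedSubscheme

theorem mem_support_of_forms (Γ : ClosedSubscheme ι K) (q : Point ι K)
    (h : ∀ d, ∀ f ∈ forms ι K d, f ∈ Γ.ideal → MvPolynomial.eval q.coords f = 0) :
    q ∈ Γ.support := fun f hf =>
  mem_of_components_mem (RingHom.ker (MvPolynomial.eval q.coords)) f fun d =>
    h d _ (component_mem_forms f d) (Γ.multihomogeneous f hf d)

namespace IsCoordinateHom

variable {Γ : ClosedSubscheme ι K} {B : Type*} [CommRing B] [Algebra K B] {a : ι → K}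
  {ψ : MvPolynomial (ι × Fin 2) K →ₐ[K] B} (h : Γ.IsCoordinateHom a ψ)
include h

/-- A relation `P = 0` in `B`, homogenized with `lᵢ`, becomes a form in the ideal of `Γ`. -/
theorem homogenized_eval_eq_zero {q : Point ι K} (hq : q ∈ Γ.support) (i : ι) (j : Fin 2)
    (P : Polynomial K) (hP : Polynomial.aeval (ψ (MvPolynomial.X (i, j))) P = 0) :
    ∑ n ∈ Finset.range (P.natDegree + 1), P.coeff n * q.coords (i, j) ^ n *
      MvPolynomial.eval q.coords (lin i ![1, a i]) ^ (P.natDegree - n) = 0 := by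
  set F : MvPolynomial (ι × Fin 2) K := ∑ n ∈ Finset.range (P.natDegree + 1),
    P.coeff n • (MvPolynomial.X (i, j) ^ n * lin i ![1, a i] ^ (P.natDegree - n)) with hF
  have hFmem : F ∈ forms ι K (P.natDegree • Pi.single i 1) := by
    refine Submodule.sum_mem _ fun n hn => Submodule.smul_mem _ _ ?_
    have := mul_mem_forms (pow_mem_forms (X_mem_forms (K := K) (i, j)) n)
      (pow_mem_forms (lin_mem_forms i ![1, a i]) (P.natDegree - n))
    rwa [← add_smul, Nat.add_sub_of_le (Nat.lt_succ_iff.mp (Finset.mem_range.mp hn))] at this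
  have hψF : ψ F = 0 := by
    rw [← hP, Polynomial.aeval_eq_sum_range]
    simp [hF, h.map_lin]
  have := hq F ((h.map_eq_zero_iff _ F hFmem).mp hψF)
  rw [← this, hF]
  simp [MvPolynomial.smul_eq_C_mul, mul_assoc]

theorem eval_lin_ne_zero [FiniteDimensional K B] {q : Point ι K} (hq : q ∈ Γ.support) (i : ι) :
    MvPolynomial.eval q.coords (lin i ![1, a i]) ≠ 0 := by
  intro h0
  obtain ⟨j, hj⟩ : ∃ j, q.coords (i, j) ≠ 0 := Function.ne_iff.mp (q i).rep_nonzero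
  have hint : IsIntegral K (ψ (MvPolynomial.X (i, j))) := IsIntegral.of_finite K _
  -- If `lᵢ(q) = 0`, only the leading term of the monic minimal polynomial survives, forcing
  -- `q_{i,j} = 0`.
  have h1 := h.homogenized_eval_eq_zero hq i j _ (minpoly.aeval K _)
  rw [Finset.sum_range_succ, Finset.sum_eq_zero, (minpoly.monic hint).coeff_natDegree] at h1
  · simp [hj] at h1
  · intro n hn
    rw [h0, zero_pow (by have := Finset.mem_range.mp hn; omega), mul_zero]

theorem finite_support [FiniteDimensional K B] : Γ.support.Finite := by
  -- Normalized by `lᵢ(q) = 1`, the coordinates of a support point are roots of finitely many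
  -- minimal polynomials, and they determine the point.
  set ev : Point ι K → ι × Fin 2 → K := fun q v =>
    q.coords v / MvPolynomial.eval q.coords (lin v.1 ![1, a v.1]) with hev
  have hfin : (Set.univ.pi fun v : ι × Fin 2 =>
      (minpoly K (ψ (MvPolynomial.X v))).rootSet K).Finite :=
    Set.Finite.pi fun v => Polynomial.rootSet_finite _ _
  refine Set.Finite.of_finite_image (f := ev) (hfin.subset ?_) ?_
  · rintro _ ⟨q, hq, rfl⟩ ⟨i, j⟩ -
    have hint : IsIntegral K (ψ (MvPolynomial.X (i, j))) := IsIntegral.of_finite K _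
    rw [Polynomial.mem_rootSet]
    refine ⟨minpoly.ne_zero hint, ?_⟩
    have h1 := h.homogenized_eval_eq_zero hq i j _ (minpoly.aeval K _)
    have h2 := h.eval_lin_ne_zero hq i
    rw [Polynomial.aeval_eq_sum_range]
    rw [← mul_eq_zero_iff_right (pow_ne_zero (minpoly K (ψ (MvPolynomial.X (i, j)))).natDegree h2),
      ← h1, Finset.sum_mul]
    refine Finset.sum_congr rfl fun n hn => ?_
    have hn' := Nat.lt_succ_iff.mp (Finset.mem_range.mp hn)
    simp only [hev, smul_eq_mul, div_pow]
    rw [← Nat.sub_add_cancel hn', pow_add, Nat.add_sub_cancel]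
    field_simp
  · intro q hq r hr hqr
    funext i
    have h1 := h.eval_lin_ne_zero hq i
    have h2 := h.eval_lin_ne_zero hr i
    refine Point.apply_eq_of_smul (c := MvPolynomial.eval q.coords (lin i ![1, a i]) /
      MvPolynomial.eval r.coords (lin i ![1, a i])) fun j => ?_
    have := congrFun hqr (i, j)
    simp only [hev] at this
    field_simp at this ⊢
    exact this

theorem point_mem_support (χ : B →ₐ[K] K) : ∃ q ∈ Γ.support, ∃ c : ι → K,
    (∀ i, c i ≠ 0) ∧ ∀ v, q.coords v = c v.1 * χ (ψ (MvPolynomial.X v)) := by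
  have hu : ∀ i, (fun j => χ (ψ (MvPolynomial.X (i, j)))) ≠ 0 := by
    intro i h0
    have h1 := congrArg χ (h.map_lin i)
    have h2 : ∀ j, χ (ψ (MvPolynomial.X (i, j))) = 0 := fun j => congrFun h0 j
    simp [lin, Fin.sum_univ_two, h2] at h1
  obtain ⟨c, hc⟩ := Point.exists_coords_mk (fun i j => χ (ψ (MvPolynomial.X (i, j)))) hu
  refine ⟨_, Γ.mem_support_of_forms _ fun d f hf hfΓ => ?_, fun i => c i, fun i => (c i).ne_zero,
    hc⟩
  have h1 := aeval_mul_of_mem_forms hf (fun i => (c i : K)) fun v => χ (ψ (MvPolynomial.X v))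
  have h2 : MvPolynomial.aeval (fun v => χ (ψ (MvPolynomial.X v))) = χ.comp ψ := by
    ext v
    simp
  rw [h2, AlgHom.comp_apply, (h.map_eq_zero_iff d f hf).mpr hfΓ, map_zero, mul_zero] at h1
  rw [← h1, funext hc, ← MvPolynomial.coe_aeval_eq_eval]
  rfl

/-- The coordinate `q_{i,1} x_{i,0} - q_{i,0} x_{i,1}` on the `i`-th factor, centred at `q`, is
nilpotent on a connected zero-dimensional subscheme with support `q`. -/
theorem isNilpotent_of_connected [IsAlgClosed K] [FiniteDimensional K B] (hΓ : Γ.Connected)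
    {q : Point ι K} (hq : q ∈ Γ.support) (i : ι) :
    IsNilpotent (ψ (lin i ![q.coords (i, 1), -q.coords (i, 0)])) := by
  have hsub : Γ.support.Subsingleton := by
    by_contra hs
    exact hΓ.isPreconnected.infinite_of_nontrivial (Set.not_subsingleton_iff.mp hs)
      h.finite_support
  rw [nilpotent_iff_mem_prime]
  intro P hP
  -- Every prime of `B` has residue field `K`, hence comes from a point of the support, which is
  -- `q`.
  have hbij := IsAlgClosed.algebraMap_bijective_of_isIntegral (k := K) (K := B ⧸ P)
  set χ : B →ₐ[K] K := ((AlgEquiv.ofBijective (Algebra.ofId K (B ⧸ P)) hbij).symm :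
    (B ⧸ P) →ₐ[K] K).comp (Ideal.Quotient.mkₐ K P) with hχ
  have hker : ∀ b, χ b = 0 → b ∈ P := by
    intro b hb
    rw [hχ, AlgHom.comp_apply, AlgEquiv.coe_toAlgHom, EmbeddingLike.map_eq_zero_iff] at hb
    exact Ideal.Quotient.eq_zero_iff_mem.mp hb
  apply hker
  obtain ⟨r, hr, c, hc, hrc⟩ := h.point_mem_support χ
  rw [hsub hq hr]
  simp only [lin, Fin.sum_univ_two, Matrix.cons_val_zero, Matrix.cons_val_one, map_add, map_mul,
    ← MvPolynomial.algebraMap_eq, AlgHom.commutes, hrc, Algebra.algebraMap_self, RingHom.id_apply]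
  ring

end IsCoordinateHom

end ClosedSubscheme

end Support

/-! ## Monogenic local algebras of dimension three -/

section Monogenic

open Polynomial

variable {K B : Type*} [Field K] [CommRing B] [Algebra K B]

/-- The minimal polynomial of a generator has degree `n`, and nilpotency makes it a power of `X`. -/
theorem aeval_eq_zero_iff_X_pow_dvd {n : ℕ} [NeZero n] (hB : Module.finrank K B = n) {t : B}
    (ht : IsNilpotent t) (htop : Algebra.adjoin K {t} = ⊤) (p : K[X]) :
    aeval t p = 0 ↔ X ^ n ∣ p := by
  have : FiniteDimensional K B := Module.finite_of_finrank_pos (hB ▸ NeZero.pos n)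
  have hint : IsIntegral K t := IsIntegral.of_finite K t
  have hdeg : (minpoly K t).natDegree = n := by
    rw [← hB, ← Algebra.adjoin.powerBasis_dim hint, ← PowerBasis.finrank, htop]
    exact (Subalgebra.topEquiv (R := K) (A := B)).toLinearEquiv.finrank_eq
  obtain ⟨m, hm⟩ := ht
  have hdvd : minpoly K t ∣ X ^ m := minpoly.dvd K t (by simp [hm])
  obtain ⟨j, -, hj⟩ := (dvd_prime_pow prime_X _).mp hdvd
  have heq := eq_of_monic_of_associated (minpoly.monic hint) (monic_X_pow j) hj
  rw [heq, natDegree_X_pow] at hdeg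
  rw [minpoly.dvd_iff.symm, heq, hdeg]

/-- A nilpotent polynomial in `t` has no constant term. If its linear term also vanished, then `s² =
0`, against the minimal polynomial `X³` of the generator `s`. -/
theorem exists_eq_of_isNilpotent (hB : Module.finrank K B = 3) {t s : B}
    (ht : IsNilpotent t) (htop : Algebra.adjoin K {t} = ⊤) (hs : IsNilpotent s)
    (hgen : Algebra.adjoin K {s} = ⊤) :
    ∃ a b : K, a ≠ 0 ∧ s = algebraMap K B a * t + algebraMap K B b * t ^ 2 := by
  have hta := aeval_eq_zero_iff_X_pow_dvd hB ht htop
  have hsa := aeval_eq_zero_iff_X_pow_dvd hB hs hgen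
  have ht3 : t ^ 3 = 0 := by simpa using (hta (X ^ 3)).mpr dvd_rfl
  have hs3 : s ^ 3 = 0 := by simpa using (hsa (X ^ 3)).mpr dvd_rfl
  obtain ⟨p, rfl⟩ : ∃ p : K[X], aeval t p = s := by
    have : s ∈ Algebra.adjoin K {t} := htop ▸ Algebra.mem_top
    rwa [Algebra.adjoin_singleton_eq_range_aeval] at this
  have hp : X ∣ p := by
    rw [← map_pow, hta] at hs3
    exact prime_X.dvd_of_dvd_pow ((dvd_pow_self X three_ne_zero).trans hs3)
  obtain ⟨r, rfl⟩ := hp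
  have hs : aeval t (X * r) =
      algebraMap K B (r.coeff 0) * t + algebraMap K B (r.coeff 1) * t ^ 2 := by
    have hr := divX_mul_X_add r
    have hr' := divX_mul_X_add r.divX
    rw [← hr', coeff_divX] at hr
    conv_lhs => rw [← hr]
    simp only [map_mul, map_add, aeval_X, aeval_C]
    linear_combination (aeval t r.divX.divX) * ht3
  refine ⟨_, _, ?_, hs⟩
  intro h0
  have h2 : aeval (aeval t (X * r)) (X ^ 2 : K[X]) = 0 := by
    rw [map_pow, aeval_X, hs, h0, map_zero]
    linear_combination (algebraMap K B (r.coeff 1)) ^ 2 * t * ht3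
  rw [hsa, X_pow_dvd_iff] at h2
  simpa using h2 2 (by norm_num)

end Monogenic

/-! ### Recognizing Γ as a jet of a line. -/

section Structure

open Polynomial

namespace ClosedSubscheme

variable {ι : Type u₁} {K : Type u₂} [Fintype ι] [DecidableEq ι] [Field K] [IsAlgClosed K]

/-- A connected subscheme of degree three with all projections of degree three is a jet of a
line. -/
theorem exists_eq_jetScheme [Nonempty ι] (Γ : ClosedSubscheme ι K) (hdeg : Γ.HasDegree 3)
    (hconn : Γ.Connected) (hproj : ∀ i, (Γ.image i).HasDegree 3) :
    ∃ (v w : ι → Fin 2 → K) (h : IsFrame v w), Γ = jetScheme v w h 3 := by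
  obtain ⟨B, _, _, a, ψ, hψ⟩ := Γ.exists_isCoordinateHom
  have hB : Module.finrank K B = 3 := hψ.finrank_eq hdeg
  have : FiniteDimensional K B := Module.finite_of_finrank_pos (by omega)
  obtain ⟨q, hq⟩ := hconn.nonempty
  set l : ι → K := fun i => MvPolynomial.eval q.coords (lin i ![1, a i]) with hl
  have hl0 : ∀ i, l i ≠ 0 := fun i => hψ.eval_lin_ne_zero hq i
  have hl' : ∀ i, l i = q.coords (i, 0) + a i * q.coords (i, 1) := by
    intro i
    rw [hl]
    simp [eval_lin]
  set t : ι → B := fun i => ψ (lin i ![q.coords (i, 1), -q.coords (i, 0)]) with ht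
  have htn : ∀ i, IsNilpotent (t i) := fun i => hψ.isNilpotent_of_connected hconn hq i
  -- The vector `rᵢ` spans the kernel of `lᵢ`, so `qᵢ, rᵢ` is a basis of `K²`; `hX` expands the
  -- coordinates in it, `tᵢ` being the coordinate along `rᵢ` up to scale.
  set r : ι → Fin 2 → K := fun i => ![a i, -1] with hr
  have hX : ∀ i j, ψ (MvPolynomial.X (i, j)) = algebraMap K B ((l i)⁻¹ * q.coords (i, j)) +
      algebraMap K B ((l i)⁻¹ * r i j) * t i := by
    intro i j
    have hinv : (algebraMap K B (l i)⁻¹) * algebraMap K B (l i) = 1 := by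
      rw [← map_mul, inv_mul_cancel₀ (hl0 i), map_one]
    have hlin := hψ.map_lin i
    have hli : algebraMap K B (l i) = algebraMap K B (q.coords (i, 0)) +
        algebraMap K B (a i) * algebraMap K B (q.coords (i, 1)) := by
      rw [hl', map_add, map_mul]
    rw [hli] at hinv
    simp only [ht, hr, lin, Fin.sum_univ_two, Matrix.cons_val_zero, Matrix.cons_val_one, map_add,
      map_mul, ← MvPolynomial.algebraMap_eq, AlgHom.commutes, map_one, map_neg] at hlin ⊢
    fin_cases j
    · simp
      linear_combination (-ψ (MvPolynomial.X (i, 0))) * hinv +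
        algebraMap K B (l i)⁻¹ * algebraMap K B (q.coords (i, 0)) * hlin
    · simp
      linear_combination (-ψ (MvPolynomial.X (i, 1))) * hinv +
        algebraMap K B (l i)⁻¹ * algebraMap K B (q.coords (i, 1)) * hlin
  have htop : ∀ i, Algebra.adjoin K {t i} = ⊤ := by
    intro i
    rw [eq_top_iff]
    intro b _
    obtain ⟨g, rfl⟩ := hψ.exists_rename_eq i (hB.symm ▸ hproj i) b
    rw [← AlgHom.comp_apply]
    have : (⊤ : Subalgebra K (MvPolynomial (Unit × Fin 2) K)).map
        (ψ.comp (MvPolynomial.rename fun v : Unit × Fin 2 => (i, v.2))) ≤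
        Algebra.adjoin K {t i} := by
      rw [← MvPolynomial.adjoin_range_X, AlgHom.map_adjoin, Algebra.adjoin_le_iff]
      rintro _ ⟨_, ⟨v, rfl⟩, rfl⟩
      simp only [AlgHom.comp_apply, MvPolynomial.rename_X, hX]
      exact add_mem (Subalgebra.algebraMap_mem _ _) (mul_mem (Subalgebra.algebraMap_mem _ _)
        (Algebra.subset_adjoin rfl))
    exact this ⟨g, Algebra.mem_top, rfl⟩
  set s := t (Classical.arbitrary ι) with hs
  have hsa := aeval_eq_zero_iff_X_pow_dvd hB (htn (Classical.arbitrary ι)) (htop _)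
  have hs3 : s ^ 3 = 0 := by simpa using (hsa (X ^ 3)).mpr dvd_rfl
  choose α β hα hts using fun i => exists_eq_of_isNilpotent hB (htn (Classical.arbitrary ι))
    (htop _) (htn i) (htop i)
  set v : ι → Fin 2 → K := fun i j => (l i)⁻¹ * q.coords (i, j) with hv
  set w : ι → Fin 2 → K := fun i j => α i * ((l i)⁻¹ * r i j) - β i / α i * v i j with hw
  have hvw : IsFrame v w := by
    intro i
    have : v i 0 * w i 1 - v i 1 * w i 0 = -(α i * (l i)⁻¹) := by
      have h1 := hl' i
      have h2 := hl0 i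
      simp only [hv, hw, hr, Matrix.cons_val_zero, Matrix.cons_val_one]
      have h3 : (l i)⁻¹ * (q.coords (i, 0) + a i * q.coords (i, 1)) = 1 := by
        rw [← h1, inv_mul_cancel₀ h2]
      linear_combination (-(α i * (l i)⁻¹)) * h3
    rw [this]
    exact neg_ne_zero.mpr (mul_ne_zero (hα i) (inv_ne_zero (hl0 i)))
  -- Modulo `s³`, the product of this unit with `v + (α s + β s²) l⁻¹ r` is `v + s w`, which
  -- explains the form of `w`.
  set c : ι → B := fun i => 1 - algebraMap K B (β i / α i) * s with hc
  have hcu : ∀ i, IsUnit (c i) := fun i =>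
    IsNilpotent.isUnit_one_sub ((Commute.all _ _).isNilpotent_mul_left (htn _))
  have hline : ∀ x : ι × Fin 2, aeval s (line v w x.1 x.2) = c x.1 * ψ (MvPolynomial.X x) := by
    rintro ⟨i, j⟩
    have h1 : algebraMap K B (β i / α i) * algebraMap K B (α i) = algebraMap K B (β i) := by
      rw [← map_mul, div_mul_cancel₀ _ (hα i)]
    rw [hX, hts i]
    simp only [line, hw, hc, map_add, map_mul, map_sub, aeval_X, aeval_C]
    simp only [hv, map_mul]
    linear_combination (algebraMap K B (l i)⁻¹ * algebraMap K B (r i j) * s ^ 2) * h1 +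
      algebraMap K B (β i / α i) * algebraMap K B (l i)⁻¹ * algebraMap K B (r i j) *
        algebraMap K B (β i) * hs3
  have hmem : ∀ d, ∀ f ∈ forms ι K d, f ∈ Γ.ideal ↔ f ∈ (jetScheme v w hvw 3).ideal := by
    intro d f hf
    have h1 : (aeval s).comp (restrictLine v w) =
        MvPolynomial.aeval (fun x : ι × Fin 2 => c x.1 * ψ (MvPolynomial.X x)) := by
      ext x
      simp [restrictLine, hline]
    have h2 : MvPolynomial.aeval (fun x : ι × Fin 2 => ψ (MvPolynomial.X x)) = ψ := by
      ext x
      simp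
    have h3 : aeval s (restrictLine v w f) = (∏ i, c i ^ d i) * ψ f := by
      rw [← AlgHom.comp_apply, h1, aeval_mul_of_mem_forms hf, h2]
    have h4 : IsUnit (∏ i, c i ^ d i) :=
      Finset.prod_induction _ IsUnit (fun _ _ => IsUnit.mul) isUnit_one
        fun i _ => (hcu i).pow _
    rw [mem_jetScheme_iff hf, ← hsa, h3, h4.mul_right_eq_zero, hψ.map_eq_zero_iff d f hf]
  exact ⟨v, w, hvw, ClosedSubscheme.ext (le_antisymm
    (ideal_le_of_forms _ _ fun d f hf => (hmem d f hf).mp)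
    (ideal_le_of_forms _ _ fun d f hf => (hmem d f hf).mpr))⟩

end ClosedSubscheme

end Structure

end MultiP1

/-! ### Assembly of the theorem. -/

theorem mainTheorem4 {K : Type*} [Field K] [IsAlgClosed K] (k : ℕ) (hk : 3 ≤ k)
    (hchar : k = 4 → ringChar K ≠ 3)
    (Γ : MultiP1.ClosedSubscheme (Fin k) K) (hdeg : Γ.HasDegree 3) (hconn : Γ.Connected)
    (hcurv : Γ.Curvilinear) (hproj : ∀ i, (Γ.image i).HasDegree 3) :
    (∃! β : MultiP1.ClosedSubscheme (Fin k) K, β ≤ Γ ∧ β.HasDegree 2) ∧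
    ∀ β : MultiP1.ClosedSubscheme (Fin k) K, β ≤ Γ → β.HasDegree 2 →
      (k = 3 →
        (∀ p : ℙ K (MultiP1.SegreCoords (Fin k) K),
          p.submodule ≤ MultiP1.segreSpan Γ → ¬ p.submodule ≤ MultiP1.segreSpan β →
            2 ≤ MultiP1.segreRank p ∧ MultiP1.segreRank p ≤ 3) ∧
        HoldsGenerally (MultiP1.segreSpan Γ) fun p => MultiP1.segreRank p = 2) ∧
      (4 ≤ k →
        ∀ p : ℙ K (MultiP1.SegreCoords (Fin k) K),
          p.submodule ≤ MultiP1.segreSpan Γ → ¬ p.submodule ≤ MultiP1.segreSpan β →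
            MultiP1.segreRank p = k - 1) := by
  have : Nonempty (Fin k) := ⟨⟨0, by omega⟩⟩
  obtain ⟨v, w, h, rfl⟩ := Γ.exists_eq_jetScheme hdeg hconn hproj
  have hβ : ∀ β, β ≤ MultiP1.jetScheme v w h 3 → β.HasDegree 2 →
      β = MultiP1.jetScheme v w h 2 := fun β =>
    β.eq_jetScheme_two h (Classical.arbitrary _)
  have hp : ∀ p : ℙ K (MultiP1.SegreCoords (Fin k) K),
      p.submodule ≤ MultiP1.segreSpan (MultiP1.jetScheme v w h 3) →
      ¬ p.submodule ≤ MultiP1.segreSpan (MultiP1.jetScheme v w h 2) →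
      ∃ a b c : K, c ≠ 0 ∧ p.rep = a • MultiP1.jetTensor v w 0 + b • MultiP1.jetTensor v w 1 +
        c • MultiP1.jetTensor v w 2 := by
    intro p hp3 hp2
    rw [Projectivization.submodule_eq, Submodule.span_singleton_le_iff_mem] at hp3 hp2
    obtain ⟨a, b, c, habc⟩ := (MultiP1.mem_segreSpan_jetScheme_three h _).mp hp3
    refine ⟨a, b, c, ?_, habc⟩
    rintro rfl
    apply hp2
    rw [habc, zero_smul, add_zero]
    exact MultiP1.mem_segreSpan_jetScheme_two h a b
  refine ⟨⟨_, ⟨MultiP1.jetScheme_le_jetScheme h (by norm_num), MultiP1.hasDegree_jetScheme h 2⟩,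
    fun β hβ' => hβ β hβ'.1 hβ'.2⟩, ?_⟩
  rintro β hβ3 hβ2
  obtain rfl := hβ β hβ3 hβ2
  refine ⟨fun hk3 => ⟨fun p hp3 hp2 => ?_, ?_⟩, fun hk4 p hp3 hp2 => ?_⟩
  · obtain ⟨a, b, c, hc, habc⟩ := hp p hp3 hp2
    exact MultiP1.segreRank_mem_of_eq_three h hk3 p hc habc
  · exact MultiP1.holdsGenerally_segreRank_eq_two h hk3 _ (MultiP1.mem_segreSpan_jetScheme_three h)
  · obtain ⟨a, b, c, hc, habc⟩ := hp p hp3 hp2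
    refine MultiP1.segreRank_eq_of_four_le h hk4 (fun hk => ?_) p hc habc
    intro h3
    have hdvd : ringChar K ∣ 3 := ringChar.dvd (by exact_mod_cast h3)
    rcases (Nat.dvd_prime Nat.prime_three).mp hdvd with h1 | h1
    · exact CharP.ringChar_ne_one h1
    · exact hchar hk h1
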